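/- **Conventions.** Graphs are finite directed multigraphs. For a graph $H$ and $S\subseteq V(H)$, $\mathbf{dist}_H(u,v,S)$ is the minimum, over all paths from $u$ to $v$ in $H$, of the number of vertices of $S\setminus\{v\}$ on the path ($\infty$ if there is no path). $E(A)$ is the set of edges incident to $A$, and for a family $X$ of sets, $\mathrm{Flatten}(X)=\bigcup_{x\in X}x$. *Separators.* $\mathrm{OutSeparator}(r,H,S,d)$ returns disjoint sets $S_{Sep}\subseteq S$ and $V_{Sep}\ni r$ of vertices of $H$ such that $\mathbf{dist}_H(r,v,S)\le d$ for all $v\in V_{Sep}\cup S_{Sep}$, and in $H\setminus E(S_{Sep})$ no vertex of $V_{Sep}$ reaches a vertex outside $V_{Sep}\cup S_{Sep}$. $\mathrm{InSeparator}$ is the same with all directions reversed ($\mathbf{dist}_H(v,r,S)\le d$, and no vertex outside $V_{Sep}\cup S_{Sep}$ reaches $V_{Sep}$). (Any such pair may be returned, in particular a balanced one.) *GES-trees.* A GES-tree of depth $d$ with root $r$ on $H$ (with respect to $S$) reports a vertex $v$ with $\max\{\mathbf{dist}_H(r,v,S),\mathbf{dist}_H(v,r,S)\}>d$, called unreachable,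 as long as there is one. The *far separator* of an unreachable $v$ is $\mathrm{InSeparator}(v,H,S,d/2)$ if $\mathbf{dist}_H(r,v,S)>d$, and $\mathrm{OutSeparator}(v,H,S,d/2)$ otherwise. *$\mathrm{Split}(H,S,d)$* returns a set $S_{Split}\subseteq S$ and a partition $P$ of $V(H)$. Start with $S_{Split}=P=\emptyset$, $H'=H$. While $H'\neq\emptyset$: pick any vertex $r$ of $H'$ and compute $\mathrm{OutSeparator}(r,H',S,d/16)$ and $\mathrm{InSeparator}(r,H',S,d/16)$; let $(S',V')$ be the one finishing first if its $V$-part has at most $\frac23|V(H)|$ vertices, and otherwise the other one. If $|V'|\le\frac23|V(H)|$, add $S'$ and the separator set of $\mathrm{Split}(H'[V'],V'\cap S,d)$ to $S_{Split}$, add the parts of that recursive call and all $\{s\}$, $s\in S'$, to $P$, and remove $V'\cup S'$ from $H'$. Otherwise start a GES-tree of depth $d/2$ with root $r$ on $H'$; while it has an unreachable vertex, take its far separator $(S'',V'')$ in the current $H'$, remove $V''\cup S''$ from $H'$, call $\mathrm{Split}$ on the pruned graph induced by $V''$ (with $V''\cap S$ and $d$), and add $S''$, the recursive separator set, the recursive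 parts and the sets $\{s\}$, $s\in S''$, as before; finally add the remaining vertex set as one part to $P$ and stop. *The algorithm.* Let $G=(V,E)$ have $n$ vertices, and let $\delta\ge 32$ be a real number (so that every depth passed to a separator procedure is at least $1$). For each level $i=0,\dots,\lfloor\lg n\rfloor$ there are a partition $\hat V_i$ of $V$ (its members are called nodes), a set $S_i\subseteq V$, and the graph $\hat G_i$ with node set $\hat V_i$ and the current edges of $G$. Here $\hat V_0$ is the set of singletons and $S_0=V$; the $S_i$-distances in $\hat G_i$ are taken with respect to the nodes $\{s\}$, $s\in S_i$. Each $X\in\hat V_{i+1}$, viewed as a set of nodes of $\hat V_i$, carries a GES-tree of depth $\delta$ on $\hat G_i[X]$ with a root vertex $r\in\mathrm{Flatten}(X)$ (the tree is rooted at the node containing $r$). *Initializing* a tree on a node set $X_{Init}$ means choosing its root uniformly at random from $\mathrm{Flatten}(X_{Init})$, independently of all other roots. *Preprocessing*: for $i=0,\dots,\lfloor\lg n\rfloor$ let $(S_{i+1},\hat V_{i+1})$ be the (flattened) result of $\mathrm{Split}(\hat G_i,S_i,\delta/2)$ and initialize a tree on every part. *Deletion of an edge*: remove it; then for $i=0,\dots,\lfloor\lg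 n\rfloor$ in this order, while some tree on level $i$, with current node set $X$, has an unreachable node, let $(S_{Sep},V_{Sep})$ be the far separator of such a node in $\hat G_i[X]$ and do the following. - If $|\mathrm{Flatten}(V_{Sep})|\le\frac23|\mathrm{Flatten}(X)|$: remove $V_{Sep}\cup S_{Sep}$ from the tree, which otherwise persists with its root; call $\mathrm{Split}(\hat G_i[V_{Sep}],V_{Sep}\cap S_i,\delta/2)$; initialize new trees on all its parts and on all single nodes of $S_{Sep}$; add $S_{Sep}$ and the separator set of the call to $S_{i+1}$. - Otherwise: **delete the whole tree**, let $(S'',P'')=\mathrm{Split}(\hat G_i[X],X\cap S_i,\delta/2)$, initialize new trees on all parts of $P''$, and add $S''$ to $S_{i+1}$. All choices left open are resolved by arbitrary deterministic rules (a subroutine call on level $i$ sees its arguments; the selection of the next tree sees the current graph, $S_i$ and the state of level $i$). The adversary is oblivious: the sequence of edge deletions is an arbitrary sequence fixed independently of the random roots. **Lemma.** Consider a GES-tree that is initialized, at any moment of the algorithm, on a node set $X_{Init}$ of some level $i$. Conditioned on the whole history (all roots chosen before that call of the initialization), with probability at least $\frac23$ the following holds: if the tree is at some later time deleted as a whole in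 the second case above, then every part $X'$ of the partition $P''$ computed at that moment satisfies $|\mathrm{Flatten}(X')|\le\frac23|\mathrm{Flatten}(X_{Init})|$. -/

import Mathlib

open scoped Classical

namespace DecrementalSCC

/-! ## Node graphs and `S`-distances -/

/-- A finite directed graph given by its vertex set and its adjacency relation.  Parallel edges are
irrelevant for everything below and are not recorded here; walks stay inside `verts`. -/
structure NodeGraph (α : Type*) where
  verts : Finset α
  Adj : α → α → Prop

namespace NodeGraph

variable {α : Type*}

/-- The induced subgraph `G[U]`. -/
noncomputable def induce (G : NodeGraph α) (U : Finset α) : NodeGraph α :=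
  ⟨G.verts ∩ U, G.Adj⟩

/-- The graph `G[V(G) \ U]`. -/
noncomputable def remove (G : NodeGraph α) (U : Finset α) : NodeGraph α :=
  ⟨G.verts \ U, G.Adj⟩

/-- The graph `G \ E(U)`: same vertices, all edges incident to `U` deleted. -/
def cutEdges (G : NodeGraph α) (U : Finset α) : NodeGraph α :=
  ⟨G.verts, fun u v => G.Adj u v ∧ u ∉ U ∧ v ∉ U⟩

/-- `G.SWalk S u v k`: there is a walk from `u` to `v` in `G` of length `k`, where an edge leaving
a vertex of `S` has length `1` and every other edge has length `0`. -/
inductive SWalk (G : NodeGraph α) (S : Finset α) : α → α → ℕ → Prop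
  | nil {u : α} : u ∈ G.verts → SWalk G S u u 0
  | cons {u w v : α} {k : ℕ} : u ∈ G.verts → G.Adj u w → SWalk G S w v k →
      SWalk G S u v ((if u ∈ S then 1 else 0) + k)

/-- The `S`-distance `dist_G(u, v, S)`: the minimum number of vertices of `S \ {v}` on a path from
`u` to `v` (`⊤` if there is no path). -/
noncomputable def sdist (G : NodeGraph α) (S : Finset α) (u v : α) : ℕ∞ :=
  ⨅ (k : ℕ) (_ : G.SWalk S u v k), (k : ℕ∞)

/-- `u` reaches `v` in `G`. -/
def Reaches (G : NodeGraph α) (u v : α) : Prop := ∃ k, G.SWalk ∅ u v k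

end NodeGraph

/-- Being at most the real number `d ≥ 0`, for an extended natural number. -/
def AtMost (k : ℕ∞) (d : ℝ) : Prop := k ≤ (⌊d⌋₊ : ℕ∞)

/-- The vertex `v` is unreachable for a generalized Even-Shiloach tree of depth `d` rooted at `r`
that runs on `G` with respect to `S`-distances. -/
def IsFar {α : Type*} (G : NodeGraph α) (S : Finset α) (r : α) (d : ℝ) (v : α) : Prop :=
  v ∈ G.verts ∧ (¬ AtMost (G.sdist S r v) d ∨ ¬ AtMost (G.sdist S v r) d)

/-! ## Separators -/

/-- `p = (S_Sep, V_Sep)` is an admissible answer of `OutSeparator(r, G, S, d)`.  No bound on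
`|S_Sep|` is demanded, so that balanced separators are a special case. -/
def IsOutSeparator {α : Type*} (r : α) (G : NodeGraph α) (S : Finset α) (d : ℝ)
    (p : Finset α × Finset α) : Prop :=
  p.1 ⊆ S ∧ p.2 ⊆ G.verts ∧ Disjoint p.1 p.2 ∧ r ∈ p.2 ∧
  (∀ v ∈ p.2 ∪ p.1, AtMost (G.sdist S r v) d) ∧
  (∀ x ∈ p.2, ∀ y ∈ G.verts \ (p.1 ∪ p.2), ¬ (G.cutEdges p.1).Reaches x y)

/-- `p = (S_Sep, V_Sep)` is an admissible answer of `InSeparator(r, G, S, d)`. -/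
def IsInSeparator {α : Type*} (r : α) (G : NodeGraph α) (S : Finset α) (d : ℝ)
    (p : Finset α × Finset α) : Prop :=
  p.1 ⊆ S ∧ p.2 ⊆ G.verts ∧ Disjoint p.1 p.2 ∧ r ∈ p.2 ∧
  (∀ v ∈ p.2 ∪ p.1, AtMost (G.sdist S v r) d) ∧
  (∀ x ∈ p.2, ∀ y ∈ G.verts \ (p.1 ∪ p.2), ¬ (G.cutEdges p.1).Reaches y x)

/-! Admissible separators exist whenever the depth is at least `1`. -/

theorem atMost_sdist_iff {α : Type*} (G : NodeGraph α) (S : Finset α) (u v : α) (m : ℕ) :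
    G.sdist S u v ≤ (m : ℕ∞) ↔ ∃ k ≤ m, G.SWalk S u v k := by
  constructor
  · intro h
    by_contra hc
    push Not at hc
    have h1 : ((m + 1 : ℕ) : ℕ∞) ≤ G.sdist S u v := by
      refine le_iInf fun k => le_iInf fun hk => ?_
      have : m < k := by
        by_contra hkm
        exact hc k (not_lt.mp hkm) hk
      exact_mod_cast this
    have h2 := h1.trans h
    have h3 : m + 1 ≤ m := by exact_mod_cast h2
    omega
  · rintro ⟨k, hkm, hk⟩
    exact (iInf_le_of_le k (iInf_le_of_le hk le_rfl)).trans (by exact_mod_cast hkm)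

theorem NodeGraph.SWalk.left_mem {α : Type*} {G : NodeGraph α} {S : Finset α} {u v : α} {k : ℕ}
    (h : G.SWalk S u v k) : u ∈ G.verts := by
  cases h <;> assumption

theorem NodeGraph.SWalk.snoc {α : Type*} {G : NodeGraph α} {S : Finset α} {u v w : α} {k : ℕ}
    (h : G.SWalk S u v k) (hvw : G.Adj v w) (hw : w ∈ G.verts) :
    G.SWalk S u w (k + if v ∈ S then 1 else 0) := by
  induction h with
  | nil hu => simpa using NodeGraph.SWalk.cons (S := S) hu hvw (.nil hw)
  | cons hu hadj _ ih => simpa [add_assoc] using NodeGraph.SWalk.cons hu hadj (ih hvw)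

theorem exists_isOutSeparator {α : Type*} (G : NodeGraph α) (S : Finset α) {r : α} {d : ℝ}
    (hr : r ∈ G.verts) (hd : 1 ≤ d) : ∃ p, IsOutSeparator r G S d p := by
  have hd1 : 1 ≤ ⌊d⌋₊ := Nat.le_floor (by exact_mod_cast hd)
  let D : α → ℕ → Prop := fun v m => ∃ k ≤ m, G.SWalk S r v k
  refine ⟨(G.verts.filter fun v => v ∈ S ∧ D v 1 ∧ ¬ D v 0,
    G.verts.filter fun v => D v 1 ∧ ¬ (v ∈ S ∧ ¬ D v 0)), ?_, ?_, ?_, ?_, ?_, ?_⟩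
  · intro v hv
    exact (Finset.mem_filter.mp hv).2.1
  · exact Finset.filter_subset _ _
  · rw [Finset.disjoint_left]
    intro v hv hv2
    simp only [Finset.mem_filter] at hv hv2
    exact hv2.2.2 ⟨hv.2.1, hv.2.2.2⟩
  · simp only [Finset.mem_filter]
    exact ⟨hr, ⟨0, by omega, .nil hr⟩, fun h => h.2 ⟨0, le_rfl, .nil hr⟩⟩
  · intro v hv
    have : D v 1 := by
      simp only [Finset.mem_union, Finset.mem_filter] at hv
      tauto
    obtain ⟨k, hk, hw⟩ := this
    exact (atMost_sdist_iff G S r v _).mpr ⟨k, hk.trans hd1, hw⟩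
  · rintro x hx y hy ⟨k, hk⟩
    set A := G.verts.filter fun v => v ∈ S ∧ D v 1 ∧ ¬ D v 0
    set B := G.verts.filter fun v => D v 1 ∧ ¬ (v ∈ S ∧ ¬ D v 0)
    simp only [Finset.mem_sdiff, Finset.mem_union, not_or] at hy
    refine hy.2.2 ?_
    clear hy
    induction hk with
    | nil => exact hx
    | @cons u w v k hu hadj hwalk ih =>
      apply ih
      obtain ⟨hadj, _, hwA⟩ := hadj
      have hw : w ∈ G.verts := hwalk.left_mem
      simp only [A, B, Finset.mem_filter] at hx hwA ⊢
      have hDw : D w 1 := by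
        by_cases huS : u ∈ S
        · have h0 : D u 0 := by
            by_contra h0
            exact hx.2.2 ⟨huS, h0⟩
          obtain ⟨j, hj, hj2⟩ := h0
          exact ⟨_, by simp only [huS, if_true]; omega, hj2.snoc hadj hw⟩
        · obtain ⟨j, hj, hj2⟩ := hx.2.1
          exact ⟨_, by simp only [huS, if_false]; omega, hj2.snoc hadj hw⟩
      exact ⟨hw, hDw, fun h => hwA ⟨hw, h.1, hDw, h.2⟩⟩

theorem exists_isInSeparator {α : Type*} (G : NodeGraph α) (S : Finset α) {r : α} {d : ℝ}
    (hr : r ∈ G.verts) (hd : 1 ≤ d) : ∃ p, IsInSeparator r G S d p := by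
  have hd1 : 1 ≤ ⌊d⌋₊ := Nat.le_floor (by exact_mod_cast hd)
  let D : α → ℕ → Prop := fun v m => ∃ k ≤ m, G.SWalk S v r k
  refine ⟨(G.verts.filter fun v => v ∈ S ∧ D v 1 ∧ ¬ D v 0,
    G.verts.filter fun v => D v 0), ?_, ?_, ?_, ?_, ?_, ?_⟩
  · intro v hv
    exact (Finset.mem_filter.mp hv).2.1
  · exact Finset.filter_subset _ _
  · rw [Finset.disjoint_left]
    intro v hv hv2
    simp only [Finset.mem_filter] at hv hv2
    exact hv.2.2.2 hv2.2
  · simp only [Finset.mem_filter]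
    exact ⟨hr, 0, le_rfl, .nil hr⟩
  · intro v hv
    have : D v 1 := by
      simp only [Finset.mem_union, Finset.mem_filter] at hv
      rcases hv with ⟨_, k, hk, hw⟩ | ⟨_, _, h, _⟩
      · exact ⟨k, by omega, hw⟩
      · exact h
    obtain ⟨k, hk, hw⟩ := this
    exact (atMost_sdist_iff G S v r _).mpr ⟨k, hk.trans hd1, hw⟩
  · rintro x hx y hy ⟨k, hk⟩
    set A := G.verts.filter fun v => v ∈ S ∧ D v 1 ∧ ¬ D v 0
    set B := G.verts.filter fun v => D v 0
    simp only [Finset.mem_sdiff, Finset.mem_union, not_or] at hy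
    refine hy.2.2 ?_
    clear hy
    induction hk with
    | nil => exact hx
    | @cons u w v k hu hadj hwalk ih =>
      obtain ⟨hadj, huA, _⟩ := hadj
      have hw := ih hx
      simp only [A, B, Finset.mem_filter] at huA hw ⊢
      obtain ⟨j, hj, hj2⟩ := hw.2
      have hwalk2 : G.SWalk S u r _ := .cons hu hadj hj2
      refine ⟨hu, ?_⟩
      by_contra h0
      by_cases huS : u ∈ S
      · exact huA ⟨hu, huS, ⟨_, by simp only [huS, if_true]; omega, hwalk2⟩, h0⟩
      · exact h0 ⟨_, by simp only [huS, if_false]; omega, hwalk2⟩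

/-- Resolution of an arbitrary choice: the suggestion `b` if it is admissible, otherwise some
admissible element. -/
noncomputable def resolve {β : Type*} (p : β → Prop) (b : β) : β :=
  if p b then b else if h : ∃ x, p x then h.choose else b

theorem resolve_spec {β : Type*} {p : β → Prop} (h : ∃ x, p x) (b : β) : p (resolve p b) := by
  unfold resolve
  split_ifs with hb
  · exact hb
  · exact h.choose_spec

/-- The arbitrary decisions made inside `Split` and by the tree queries.  These are plain functions
without any assumption; inadmissible suggestions are overruled by `resolve`. -/
structure SubRules (α : Type*) where
  /-- the arbitrary vertex picked by `Split` -/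
  pivot : NodeGraph α → α
  /-- whether `OutSeparator` wins the race against `InSeparator` -/
  outFirst : α → NodeGraph α → Finset α → ℝ → Prop
  outSep : α → NodeGraph α → Finset α → ℝ → Finset α × Finset α
  inSep : α → NodeGraph α → Finset α → ℝ → Finset α × Finset α
  /-- the vertex returned by `GetUnreachableVertex` -/
  far : NodeGraph α → Finset α → α → ℝ → α

section Split

variable {α : Type*} (R : SubRules α)

/-- `OutSeparator(r, G, S, d) = (S_Sep, V_Sep)` -/
noncomputable def outSeparator (r : α) (G : NodeGraph α) (S : Finset α) (d : ℝ) :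
    Finset α × Finset α :=
  resolve (IsOutSeparator r G S d) (R.outSep r G S d)

/-- `InSeparator(r, G, S, d) = (S_Sep, V_Sep)` -/
noncomputable def inSeparator (r : α) (G : NodeGraph α) (S : Finset α) (d : ℝ) :
    Finset α × Finset α :=
  resolve (IsInSeparator r G S d) (R.inSep r G S d)

/-- The vertex returned by `GetUnreachableVertex` of a tree with root `r` and depth `d`, when there
is one. -/
noncomputable def getUnreachable (G : NodeGraph α) (S : Finset α) (r : α) (d : ℝ) : α :=
  resolve (IsFar G S r d) (R.far G S r d)

/-- The separator computed for the unreachable vertex `v` of a tree with root `r` and depth `d`: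
`InSeparator` if `v` is far from `r`, otherwise `OutSeparator`, both with parameter `d / 2`. -/
noncomputable def farSeparator (G : NodeGraph α) (S : Finset α) (r : α) (d : ℝ) (v : α) :
    Finset α × Finset α :=
  if ¬ AtMost (G.sdist S r v) d then inSeparator R v G S (d / 2)
  else outSeparator R v G S (d / 2)

/-- The collection `{ {s} | s ∈ A }`. -/
noncomputable def singletons (A : Finset α) : Finset (Finset α) := A.image (fun s => {s})

/-- The inner loop of `Split`: prune all vertices that are unreachable for the tree with root `r`
and depth `d / 2` on `G`, recursing with `rec` on the pruned pieces.  The first argument bounds the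
number of rounds; each round removes at least one vertex. -/
noncomputable def pruneLoop (rec : NodeGraph α → Finset α → Finset α × Finset (Finset α))
    (S : Finset α) (d : ℝ) (r : α) :
    ℕ → NodeGraph α → Finset α × Finset (Finset α) → Finset α × Finset (Finset α)
  | 0, _, acc => acc
  | m + 1, G, acc =>
    if ∃ v, IsFar G S r (d / 2) v then
      let v := getUnreachable R G S r (d / 2)
      let p := farSeparator R G S r (d / 2) v
      let q := rec (G.induce p.2) (p.2 ∩ S)
      pruneLoop rec S d r m (G.remove (p.1 ∪ p.2))
        (acc.1 ∪ p.1 ∪ q.1, acc.2 ∪ q.2 ∪ singletons p.1)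
    else (acc.1, acc.2 ∪ {G.verts})

/-- The outer loop of `Split` on an input graph with `N` vertices; `G` is the graph that is still
to be processed and `acc` the pair `(S_Split, P)` built so far. -/
noncomputable def splitLoop (rec : NodeGraph α → Finset α → Finset α × Finset (Finset α))
    (N : ℕ) (S : Finset α) (d : ℝ) :
    ℕ → NodeGraph α → Finset α × Finset (Finset α) → Finset α × Finset (Finset α)
  | 0, _, acc => acc
  | m + 1, G, acc =>
    if G.verts = ∅ then acc
    else
      let r := resolve (· ∈ G.verts) (R.pivot G)
      let pOut := outSeparator R r G S (d / 16)
      let pIn := inSeparator R r G S (d / 16)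
      let first := if R.outFirst r G S d then pOut else pIn
      let second := if R.outFirst r G S d then pIn else pOut
      let p := if 3 * first.2.card ≤ 2 * N then first else second
      if 3 * p.2.card ≤ 2 * N then
        let q := rec (G.induce p.2) (p.2 ∩ S)
        splitLoop rec N S d m (G.remove (p.1 ∪ p.2))
          (acc.1 ∪ q.1 ∪ p.1, acc.2 ∪ q.2 ∪ singletons p.1)
      else pruneLoop R rec S d r (G.verts.card + 1) G acc

/-- `Split(G, S, d)` with recursion depth bounded by the first argument. -/
noncomputable def splitAux (d : ℝ) :
    ℕ → NodeGraph α → Finset α → Finset α × Finset (Finset α)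
  | 0, _, _ => (∅, ∅)
  | m + 1, G, S =>
    splitLoop R (fun G' S' => splitAux d m G' S') G.verts.card S d (G.verts.card + 1) G (∅, ∅)

/-- `Split(G, S, d) = (S_Split, P)`.  Every recursive call is on fewer vertices, so the recursion
depth is at most the number of vertices. -/
noncomputable def split (G : NodeGraph α) (S : Finset α) (d : ℝ) :
    Finset α × Finset (Finset α) :=
  splitAux R d G.verts.card G S

end Split

/-! ## The hierarchy of graphs and the deletion procedure -/

/-- `Flatten`. -/
noncomputable def flatten {V : Type*} (A : Finset (Finset V)) : Finset V := A.sup id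

/-- A generalized Even-Shiloach tree.  Its current node set consists of the nodes of its level that
are contained in `verts`. -/
structure GES (V : Type*) where
  /-- `Flatten(X)` for the current node set `X` -/
  verts : Finset V
  /-- the root -/
  center : V
  /-- `Flatten(X_Init)` for the node set on which the tree was started -/
  initSet : Finset V
  /-- when the tree was started: during the handling of which deletion (`0` is the preprocessing),
  and in which iteration of the while loop -/
  birth : ℕ × ℕ

/-- The data kept on level `i`. -/
structure LevelState (V : Type*) where
  /-- the trees; the sets `verts` of these trees are the nodes of level `i + 1` -/
  trees : Finset (GES V)
  /-- `S_{i+1}` -/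
  sep : Finset V
  /-- the trees that were deleted as a whole so far, each with the flattened parts of the partition
  that `Split` computed at that moment -/
  deleted : List (GES V × Finset (Finset V))

/-- What level `i` sees: the node set of the graph on level `i` and the set `S_i`. -/
structure LevelInput (V : Type*) where
  nodes : Finset (Finset V)
  sep : Finset V

/-- All arbitrary decisions of the algorithm. -/
structure Rules (V : Type*) extends SubRules (Finset V) where
  /-- which of the trees having an unreachable node is treated next -/
  tree : NodeGraph (Finset V) → Finset (Finset V) → LevelState V → GES V

/-- The outcome of one batch of root choices: a root in every non-empty set. -/
abbrev RootTable (V : Type*) := ∀ X : {X : Finset V // X.Nonempty}, {v : V // v ∈ X.1}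

section Delete

variable {V : Type*} {E : Type*}

/-- The graph on the nodes `P` with the edges `F`. -/
def levelGraph (src tgt : E → V) (F : Finset E) (P : Finset (Finset V)) : NodeGraph (Finset V) :=
  ⟨P, fun A B => ∃ e ∈ F, src e ∈ A ∧ tgt e ∈ B⟩

/-- The nodes of `G` that are contained in the vertex set `X`. -/
noncomputable def nodesIn (G : NodeGraph (Finset V)) (X : Finset V) : Finset (Finset V) :=
  G.verts.filter (fun A => A ⊆ X)

/-- The node of `G` that contains the vertex `r` (the nodes are pairwise disjoint). -/
noncomputable def nodeOf (G : NodeGraph (Finset V)) (r : V) : Finset V :=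
  flatten (G.verts.filter (fun A => r ∈ A))

/-- The graph on which the tree `τ` currently runs. -/
noncomputable def treeGraph (G : NodeGraph (Finset V)) (τ : GES V) : NodeGraph (Finset V) :=
  G.induce (nodesIn G τ.verts)

/-- The tree `τ` of depth `δ` has an unreachable node. -/
def HasFar (G : NodeGraph (Finset V)) (S : Finset (Finset V)) (δ : ℝ) (τ : GES V) : Prop :=
  ∃ B, IsFar (treeGraph G τ) ((treeGraph G τ).verts ∩ S) (nodeOf G τ.center) δ B

/-- `InitNewPartition`: one tree for every (non-empty) part, with its root read off from `roots`. -/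
noncomputable def newTrees (roots : RootTable V) (birth : ℕ × ℕ) (P : Finset (Finset V)) :
    Finset (GES V) :=
  (P.subtype Finset.Nonempty).image
    (fun Y => { verts := Y.1, center := (roots Y).1, initSet := Y.1, birth := birth })

/-- One iteration of the while loop on one level.  `G` is the graph of the level and `S` the
collection of the nodes `{s}`, `s ∈ S_i`. -/
noncomputable def loopBody (R : Rules V) (δ : ℝ) (G : NodeGraph (Finset V))
    (S : Finset (Finset V)) (birth : ℕ × ℕ) (roots : RootTable V) (st : LevelState V) :
    LevelState V :=
  if ∃ τ ∈ st.trees, HasFar G S δ τ then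
    let τ := resolve (fun τ => τ ∈ st.trees ∧ HasFar G S δ τ) (R.tree G S st)
    let H := treeGraph G τ
    let r := nodeOf G τ.center
    let T := H.verts ∩ S
    let B := getUnreachable R.toSubRules H T r δ
    let p := farSeparator R.toSubRules H T r δ B
    if 3 * (flatten p.2).card ≤ 2 * τ.verts.card then
      let q := split R.toSubRules (H.induce p.2) (p.2 ∩ T) (δ / 2)
      let P := q.2.image flatten ∪ p.1
      { trees := insert { τ with verts := τ.verts \ flatten (p.1 ∪ p.2) } (st.trees.erase τ)
          ∪ newTrees roots birth P
        sep := st.sep ∪ flatten (p.1 ∪ q.1)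
        deleted := st.deleted }
    else
      let q := split R.toSubRules H T (δ / 2)
      let P := q.2.image flatten
      { trees := st.trees.erase τ ∪ newTrees roots birth P
        sep := st.sep ∪ flatten q.1
        deleted := (τ, P) :: st.deleted }
  else st

variable [Fintype V]

/-- The state of one level after the preprocessing (`t = 0`) and after the first `t` deletions.
`edges t` is the edge set after `t` deletions, `inp t` the input from the level below after `t`
deletions.  Each iteration of the while loop increases the number of trees, and there are at most
`|V|` trees, so `|V|` iterations exhaust the loop. -/
noncomputable def levelRun (src tgt : E → V) (edges : ℕ → Finset E) (δ : ℝ)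
    (R : ℕ → ℕ → Rules V) (roots : ℕ → ℕ → RootTable V) (inp : ℕ → LevelInput V) :
    ℕ → LevelState V
  | 0 =>
    let q := split (R 0 0).toSubRules (levelGraph src tgt (edges 0) (inp 0).nodes)
      (singletons (inp 0).sep) (δ / 2)
    { trees := newTrees (roots 0 0) (0, 0) (q.2.image flatten)
      sep := flatten q.1
      deleted := [] }
  | t + 1 =>
    (List.range (Fintype.card V)).foldl
      (fun st c => loopBody (R (t + 1) c) δ
        (levelGraph src tgt (edges (t + 1)) (inp (t + 1)).nodes)
        (singletons (inp (t + 1)).sep) (t + 1, c) (roots (t + 1) c) st)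
      (levelRun src tgt edges δ R roots inp t)

/-- `hierarchy … i t` is the state of level `i` after `t` deletions.  Level `0` has the singletons
as nodes and `S_0 = V`; level `i + 1` works on the nodes and on the set `S_{i+1}` provided by level
`i`, which has been updated before. -/
noncomputable def hierarchy (src tgt : E → V) (edges : ℕ → Finset E) (δ : ℝ)
    (R : ℕ → ℕ → ℕ → Rules V) (roots : ℕ → ℕ → ℕ → RootTable V) : ℕ → ℕ → LevelState V
  | 0 => levelRun src tgt edges δ (R 0) (roots 0) (fun _ => ⟨singletons Finset.univ, Finset.univ⟩)
  | i + 1 => levelRun src tgt edges δ (R (i + 1)) (roots (i + 1))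
      (fun t => ⟨(hierarchy src tgt edges δ R roots i t).trees.image GES.verts,
        (hierarchy src tgt edges δ R roots i t).sep⟩)

end Delete

/-! ## Randomness -/

/-- The coins of a run with `T` deletions: for every level `0, …, ⌊lg n⌋`, every time
`0, …, T` and every iteration of the while loop a root in every non-empty set.  The uniform
distribution on this finite product makes all roots independent and uniform. -/
def Coins (V : Type*) [Fintype V] (T : ℕ) : Type _ :=
  Fin (Nat.log 2 (Fintype.card V) + 1) → Fin (T + 1) → Fin (Fintype.card V + 1) → RootTable V

instance (V : Type*) [Fintype V] (T : ℕ) : MeasurableSpace (Coins V T) := ⊤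

/-- The coins with indices in `ℕ`; only indices inside the box are used by a run. -/
def Coins.roots {V : Type*} [Fintype V] {T : ℕ} (ω : Coins V T) (i t c : ℕ) : RootTable V :=
  ω (Fin.ofNat _ i) (Fin.ofNat _ t) (Fin.ofNat _ c)

/-- The coin tables that agree with `ω₀` on all roots chosen before iteration `c` on level `i`
during the handling of deletion `t`, that is, the event that the history up to this moment is the
one produced by `ω₀`. -/
def sameHistory {V : Type*} [Fintype V] {T : ℕ} (ω₀ : Coins V T)
    (i : Fin (Nat.log 2 (Fintype.card V) + 1)) (t : Fin (T + 1)) (c : Fin (Fintype.card V + 1)) :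
    Set (Coins V T) :=
  {ω | ∀ i' t' c', (t' < t ∨ (t' = t ∧ (i' < i ∨ (i' = i ∧ c' < c)))) → ω i' t' c' = ω₀ i' t' c'}

/-- The edges left after the first `t` of the deletions `del`. -/
noncomputable def remainingEdges {E : Type*} [Fintype E] (del : List E) (t : ℕ) : Finset E :=
  Finset.univ \ (del.take t).toFinset

end DecrementalSCC

namespace DecrementalSCC

/-! ### Walks and their images -/

namespace NodeGraph

variable {α β : Type*} {G : NodeGraph α} {S : Finset α} {u v w : α} {k l : ℕ}

/-! Fix all coins except the root of the tree started on Y = `XInit` at the given moment, and let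
this root range over Y. The nodes and the set S_i that level i receives come from lower levels, so
they, like the edge deletions, are the same for every choice of the root. Among the bad roots take
one whose first bad deletion comes latest, during deletion T say, and let X be the large part found
there, so |X| > 2/3 |Y|. No root in X causes a bad deletion up to time T, and by the choice of T no
root causes its first one later. So all bad roots lie in Y \ X, which has fewer than |Y|/3 elements
(`card_bad_roots`).

Roots in X are safe for the following reasons. `Split` with parameter δ/2 returns parts of radius at
most δ/4 in both directions (`isFinePacking_split`), so nodes of the part are within δ/2 of each
other at time T. Edges only disappear, nodes are only refined and S_i only grows, so at earlier
times the nodes meeting X are at least as close to each other (`Concentrated.isShield`). A far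
separator contains no node within δ/2 of the root in both directions (`farSeparator_spec`). Hence a
tree rooted in X keeps all of X, and a separator with more than 2/3 of the current vertices does not
fit beside X (`LevelStep.shielded`).

The history does not restrict the root in question, so averaging over its values for all other coins
fixed gives the conditional bound (`card_filter_of_resample`). -/

theorem SWalk.right_mem (h : G.SWalk S u v k) : v ∈ G.verts := by
  induction h with
  | nil hu => exact hu
  | cons _ _ _ ih => exact ih

theorem SWalk.trans (h : G.SWalk S u v k) (h' : G.SWalk S v w l) : G.SWalk S u w (k + l) := by
  induction h with
  | nil _ => simpa using h'
  | cons hu hadj _ ih => simpa [add_assoc] using SWalk.cons hu hadj (ih h')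

/-- Images of walks under a map that is only controlled on the vertices satisfying `p`. -/
theorem SWalk.map {G' : NodeGraph β} {S' : Finset β} (f : α → β) (p : α → Prop)
    (hp : ∀ a b, G.Adj a b → p b) (hv : ∀ a ∈ G.verts, p a → f a ∈ G'.verts)
    (hadj : ∀ a ∈ G.verts, ∀ b ∈ G.verts, G.Adj a b → G'.Adj (f a) (f b))
    (hS : ∀ a ∈ G.verts, ∀ b, G.Adj a b → f a ∈ S' → a ∈ S)
    (h : G.SWalk S u v k) (hu : p u) : ∃ l ≤ k, G'.SWalk S' (f u) (f v) l := by
  induction h with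
  | nil hm => exact ⟨0, le_rfl, .nil (hv _ hm hu)⟩
  | @cons u w v k hm hab hw ih =>
    obtain ⟨l, hl, hwalk⟩ := ih (hp _ _ hab)
    refine ⟨_, ?_, .cons (hv _ hm hu) (hadj _ hm _ hw.left_mem hab) hwalk⟩
    have := hS u hm w hab
    split_ifs <;> first | omega | tauto

end NodeGraph

theorem NodeGraph.mem_induce_verts {α : Type*} {G : NodeGraph α} {U : Finset α} {x : α} :
    x ∈ (G.induce U).verts ↔ x ∈ G.verts ∧ x ∈ U :=
  Finset.mem_inter

/-! ### Far separators and the radius of the parts of `Split` -/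

section Split

variable {α : Type*}

theorem atMost_sdist {G : NodeGraph α} {S : Finset α} {u v : α} {d : ℝ} :
    AtMost (G.sdist S u v) d ↔ ∃ k ≤ ⌊d⌋₊, G.SWalk S u v k :=
  atMost_sdist_iff G S u v _

/-- Real depths enter `AtMost` through their floors; this is what the triangle inequality needs when
a depth is halved. -/
theorem two_mul_floor_half_le (d : ℝ) : ⌊d / 2⌋₊ + ⌊d / 2⌋₊ ≤ ⌊d⌋₊ := by
  rcases le_total d 0 with hd | hd
  · simp [Nat.floor_of_nonpos (show d / 2 ≤ 0 by linarith)]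
  · apply Nat.le_floor
    have := Nat.floor_le (show 0 ≤ d / 2 by linarith)
    push_cast
    linarith

theorem AtMost.sdist_trans {G : NodeGraph α} {S : Finset α} {u v w : α} {d : ℝ}
    (h : AtMost (G.sdist S u v) (d / 2)) (h' : AtMost (G.sdist S v w) (d / 2)) :
    AtMost (G.sdist S u w) d := by
  obtain ⟨k, hk, hw⟩ := atMost_sdist.mp h
  obtain ⟨l, hl, hw'⟩ := atMost_sdist.mp h'
  exact atMost_sdist.mpr ⟨k + l, by have := two_mul_floor_half_le d; omega, hw.trans hw'⟩

/-- The separator `p` takes disjoint sets of vertices of `G`. -/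
def IsSubPair (G : NodeGraph α) (p : Finset α × Finset α) : Prop :=
  p.1 ⊆ G.verts ∧ p.2 ⊆ G.verts ∧ Disjoint p.1 p.2

theorem IsOutSeparator.isSubPair {r : α} {G : NodeGraph α} {S : Finset α} {d : ℝ}
    {p : Finset α × Finset α} (h : IsOutSeparator r G S d p) : IsSubPair G p := by
  refine ⟨fun v hv => ?_, h.2.1, h.2.2.1⟩
  obtain ⟨k, -, hw⟩ := atMost_sdist.mp (h.2.2.2.2.1 v (Finset.mem_union_right _ hv))
  exact hw.right_mem

theorem IsInSeparator.isSubPair {r : α} {G : NodeGraph α} {S : Finset α} {d : ℝ}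
    {p : Finset α × Finset α} (h : IsInSeparator r G S d p) : IsSubPair G p := by
  refine ⟨fun v hv => ?_, h.2.1, h.2.2.1⟩
  obtain ⟨k, -, hw⟩ := atMost_sdist.mp (h.2.2.2.2.1 v (Finset.mem_union_right _ hv))
  exact hw.left_mem

variable (R : SubRules α)

theorem outSeparator_spec {r : α} {G : NodeGraph α} (S : Finset α) {d : ℝ} (hr : r ∈ G.verts)
    (hd : 1 ≤ d) : IsOutSeparator r G S d (outSeparator R r G S d) :=
  resolve_spec (exists_isOutSeparator G S hr hd) _

theorem inSeparator_spec {r : α} {G : NodeGraph α} (S : Finset α) {d : ℝ} (hr : r ∈ G.verts)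
    (hd : 1 ≤ d) : IsInSeparator r G S d (inSeparator R r G S d) :=
  resolve_spec (exists_isInSeparator G S hr hd) _

/-- `u` and `v` are at `S`-distance at most `d` from each other. -/
def Near (G : NodeGraph α) (S : Finset α) (d : ℝ) (u v : α) : Prop :=
  AtMost (G.sdist S u v) d ∧ AtMost (G.sdist S v u) d

/-- Triangle inequality: each separator vertex w is within d/2 of v in the direction of the search.
If w were also within d/2 of r both ways, the distance that makes v unreachable would be at most d.
-/
theorem farSeparator_spec {G : NodeGraph α} {S : Finset α} {r v : α} {d : ℝ}
    (hv : IsFar G S r d v) (hd : 2 ≤ d) :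
    IsSubPair G (farSeparator R G S r d v) ∧
      ∀ w, w ∈ (farSeparator R G S r d v).1 ∨ w ∈ (farSeparator R G S r d v).2 →
        ¬ Near G S (d / 2) r w := by
  have hd' : 1 ≤ d / 2 := by linarith
  unfold farSeparator
  split_ifs with h
  · have hs := outSeparator_spec R S hv.1 hd'
    refine ⟨hs.isSubPair, fun w hw hnear => ?_⟩
    rcases hv.2 with h' | h'
    · exact h' h
    · exact h' ((hs.2.2.2.2.1 w (Finset.mem_union.mpr hw.symm)).sdist_trans hnear.2)
  · have hs := inSeparator_spec R S hv.1 hd'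
    refine ⟨hs.isSubPair, fun w hw hnear => h ?_⟩
    exact hnear.1.sdist_trans (hs.2.2.2.2.1 w (Finset.mem_union.mpr hw.symm))

/-- The graph induced by `X` has `S`-radius at most `d / 2`. -/
def Concentrated (Adj : α → α → Prop) (S : Finset α) (d : ℝ) (X : Finset α) : Prop :=
  ∃ ρ, ∀ v ∈ X, Near ⟨X, Adj⟩ S (d / 2) ρ v

/-- `P` consists of pairwise disjoint concentrated subsets of `U`. -/
structure IsFinePacking (Adj : α → α → Prop) (S : Finset α) (d : ℝ) (U : Finset α)
    (P : Finset (Finset α)) : Prop where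
  subset : ∀ X ∈ P, X ⊆ U
  disjoint : (P : Set (Finset α)).PairwiseDisjoint id
  concentrated : ∀ X ∈ P, Concentrated Adj S d X

variable {Adj : α → α → Prop} {S S' : Finset α} {d : ℝ} {U U' X : Finset α}
  {P P' : Finset (Finset α)}

theorem atMost_sdist_of_subset {G : NodeGraph α} {u v : α} (h : ∀ x ∈ G.verts, x ∈ S' → x ∈ S)
    (hd : AtMost (G.sdist S u v) d) : AtMost (G.sdist S' u v) d := by
  obtain ⟨k, hk, hw⟩ := atMost_sdist.mp hd
  obtain ⟨l, hl, hw'⟩ := hw.map (G' := G) (S' := S') id (fun _ => True) (fun _ _ _ => trivial)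
    (fun a ha _ => ha) (fun _ _ _ _ h => h) (fun a ha _ _ hS => h a ha hS) trivial
  exact atMost_sdist.mpr ⟨l, hl.trans hk, hw'⟩

/-- Distances inside X see only S ∩ X. This allows passing back from the restricted separator sets
of recursive calls and of single trees to the full one. -/
theorem Concentrated.of_subset (hX : Concentrated Adj S d X) (h : ∀ x ∈ X, x ∈ S' → x ∈ S) :
    Concentrated Adj S' d X := by
  obtain ⟨ρ, hρ⟩ := hX
  exact ⟨ρ, fun v hv => ⟨atMost_sdist_of_subset h (hρ v hv).1,
    atMost_sdist_of_subset h (hρ v hv).2⟩⟩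

theorem concentrated_singleton (Adj : α → α → Prop) (S : Finset α) (d : ℝ) (a : α) :
    Concentrated Adj S d {a} := by
  refine ⟨a, fun v hv => ?_⟩
  obtain rfl := Finset.mem_singleton.mp hv
  have : AtMost ((⟨{v}, Adj⟩ : NodeGraph α).sdist S v v) (d / 2) :=
    atMost_sdist.mpr ⟨0, Nat.zero_le _, .nil (Finset.mem_singleton_self v)⟩
  exact ⟨this, this⟩

theorem IsFinePacking.mono (h : IsFinePacking Adj S d U P) (hU : U ⊆ U') :
    IsFinePacking Adj S d U' P :=
  ⟨fun X hX => (h.subset X hX).trans hU, h.disjoint, h.concentrated⟩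

theorem IsFinePacking.of_subset (h : IsFinePacking Adj S d U P) (hS : ∀ x ∈ U, x ∈ S' → x ∈ S) :
    IsFinePacking Adj S' d U P :=
  ⟨h.subset, h.disjoint, fun X hX => (h.concentrated X hX).of_subset
    fun x hx => hS x (h.subset X hX hx)⟩

theorem pairwiseDisjoint_union {P P' : Finset (Finset α)} (hU : Disjoint U U')
    (hP : ∀ X ∈ P, X ⊆ U) (hP' : ∀ X ∈ P', X ⊆ U')
    (h : (P : Set (Finset α)).PairwiseDisjoint id) (h' : (P' : Set (Finset α)).PairwiseDisjoint id) :
    ((P ∪ P' : Finset (Finset α)) : Set (Finset α)).PairwiseDisjoint id := by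
  rw [Finset.coe_union]
  refine h.union h' fun X hX Y hY _ => hU.mono (hP X hX) (hP' Y hY)

theorem IsFinePacking.union (h : IsFinePacking Adj S d U P) (h' : IsFinePacking Adj S d U' P')
    (hU : Disjoint U U') : IsFinePacking Adj S d (U ∪ U') (P ∪ P') where
  subset X hX := by
    rcases Finset.mem_union.mp hX with hX | hX
    · exact (h.subset X hX).trans Finset.subset_union_left
    · exact (h'.subset X hX).trans Finset.subset_union_right
  disjoint := pairwiseDisjoint_union hU h.subset h'.subset h.disjoint h'.disjoint
  concentrated X hX := (Finset.mem_union.mp hX).elim (h.concentrated X) (h'.concentrated X)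

theorem isFinePacking_empty (Adj : α → α → Prop) (S : Finset α) (d : ℝ) (U : Finset α) :
    IsFinePacking Adj S d U ∅ :=
  ⟨by simp, by simp, by simp⟩

theorem isFinePacking_singletons (Adj : α → α → Prop) (S : Finset α) (d : ℝ) (U : Finset α) :
    IsFinePacking Adj S d U (singletons U) where
  subset X hX := by
    obtain ⟨a, ha, rfl⟩ := Finset.mem_image.mp hX
    simpa using ha
  disjoint := by
    intro X hX Y hY hne
    obtain ⟨a, -, rfl⟩ := Finset.mem_image.mp hX
    obtain ⟨b, -, rfl⟩ := Finset.mem_image.mp hY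
    exact Finset.disjoint_singleton.mpr fun h : a = b => hne (by rw [h])
  concentrated X hX := by
    obtain ⟨a, -, rfl⟩ := Finset.mem_image.mp hX
    exact concentrated_singleton Adj S d a

/-- The vertices already used, the separator set and its V-part are disjoint, so the three packings
combine. It covers one round of either loop of `Split` as well as, starting from the empty packing,
the pruning of a tree. -/
theorem IsFinePacking.add_separator {G : NodeGraph α} {p : Finset α × Finset α}
    {P'' : Finset (Finset α)} (h : IsFinePacking Adj S d U P) (hU : Disjoint U G.verts)
    (hp : IsSubPair G p) (h' : IsFinePacking Adj S' d U' P') (hU' : U' ⊆ p.2)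
    (hS' : ∀ x ∈ p.2, x ∈ S → x ∈ S')
    (hP'' : ∀ X ∈ P'', X ∈ P ∨ X ∈ P' ∨ ∃ a ∈ p.1, X = {a}) :
    IsFinePacking Adj S d (U ∪ (p.1 ∪ p.2)) P'' := by
  have h2 : IsFinePacking Adj S d p.2 P' := (h'.of_subset fun x hx => hS' x (hU' hx)).mono hU'
  have h3 := (h.union h2 (hU.mono_right hp.2.1)).union (isFinePacking_singletons Adj S d p.1)
    (Finset.disjoint_union_left.mpr ⟨hU.mono_right hp.1, hp.2.2.symm⟩)
  have h4 : P'' ⊆ P ∪ P' ∪ singletons p.1 := by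
    intro X hX
    rcases hP'' X hX with hX | hX | ⟨a, ha, rfl⟩
    · simp [hX]
    · simp [hX]
    · exact Finset.mem_union_right _ (Finset.mem_image_of_mem _ ha)
  refine ⟨fun X hX => (h3.subset X (h4 hX)).trans fun x => ?_,
    h3.disjoint.subset (Finset.coe_subset.mpr h4), fun X hX => h3.concentrated X (h4 hX)⟩
  simp only [Finset.mem_union]
  tauto

theorem IsFinePacking.add_recursive {G : NodeGraph α} {p : Finset α × Finset α}
    (h : IsFinePacking Adj S d U P) (hU : Disjoint U G.verts) (hp : IsSubPair G p)
    (h' : IsFinePacking Adj (p.2 ∩ S) d (G.verts ∩ p.2) P') :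
    IsFinePacking Adj S d (U ∪ (p.1 ∪ p.2)) (P ∪ P' ∪ singletons p.1) := by
  refine h.add_separator hU hp h' Finset.inter_subset_right
    (fun x hx hS => Finset.mem_inter.mpr ⟨hx, hS⟩) fun X hX => ?_
  simpa only [Finset.mem_union, singletons, Finset.mem_image, or_assoc, eq_comm] using hX

theorem union_remove_subset {G : NodeGraph α} {p : Finset α × Finset α} (hp : IsSubPair G p) :
    U ∪ (p.1 ∪ p.2) ∪ (G.remove (p.1 ∪ p.2)).verts ⊆ U ∪ G.verts := by
  intro x hx
  simp only [NodeGraph.remove, Finset.mem_union, Finset.mem_sdiff] at hx ⊢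
  have := @hp.1 x
  have := @hp.2.1 x
  tauto

theorem disjoint_union_remove {G : NodeGraph α} {A : Finset α} (hU : Disjoint U G.verts) :
    Disjoint (U ∪ A) (G.remove A).verts :=
  Finset.disjoint_union_left.mpr ⟨hU.mono_right Finset.sdiff_subset, Finset.disjoint_sdiff⟩

/-- Covering all vertices is not claimed, so running out of rounds is harmless. The bound 4 ≤ d
makes the separator depth d/4 at least 1. -/
theorem isFinePacking_pruneLoop {rec : NodeGraph α → Finset α → Finset α × Finset (Finset α)}
    (hd : 4 ≤ d) (hrec : ∀ G S, IsFinePacking G.Adj S d G.verts (rec G S).2) (r : α) (m : ℕ)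
    (G : NodeGraph α) (U : Finset α) (acc : Finset α × Finset (Finset α))
    (hU : Disjoint U G.verts) (hacc : IsFinePacking G.Adj S d U acc.2) :
    IsFinePacking G.Adj S d (U ∪ G.verts) (pruneLoop R rec S d r m G acc).2 := by
  induction m generalizing G U acc with
  | zero => exact hacc.mono Finset.subset_union_left
  | succ m ih =>
    unfold pruneLoop
    split_ifs with hfar
    · have hv := resolve_spec hfar (R.far G S r (d / 2))
      obtain ⟨hp, -⟩ := farSeparator_spec R hv (by linarith)
      refine (ih (G.remove _) _ _ (disjoint_union_remove hU) ?_).mono (union_remove_subset hp)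
      exact hacc.add_recursive hU hp (hrec (G.induce _) _)
    · refine hacc.union ⟨by simp, by simp, fun X hX => ?_⟩ hU
      obtain rfl := Finset.mem_singleton.mp hX
      -- The loop stops because nothing is far from r, so r is a centre of the remaining part.
      refine ⟨r, fun v hv => ?_⟩
      by_contra hc
      exact hfar ⟨v, hv, by simpa only [Near, not_and_or] using hc⟩

/-- Which separator wins and how large it is do not matter, as both are disjoint pairs in the
current graph. Both exist because d/16 ≥ 1. -/
theorem isFinePacking_splitLoop {rec : NodeGraph α → Finset α → Finset α × Finset (Finset α)}
    (hd : 16 ≤ d) (hrec : ∀ G S, IsFinePacking G.Adj S d G.verts (rec G S).2) (N m : ℕ)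
    (G : NodeGraph α) (U : Finset α) (acc : Finset α × Finset (Finset α))
    (hU : Disjoint U G.verts) (hacc : IsFinePacking G.Adj S d U acc.2) :
    IsFinePacking G.Adj S d (U ∪ G.verts) (splitLoop R rec N S d m G acc).2 := by
  induction m generalizing G U acc with
  | zero => exact hacc.mono Finset.subset_union_left
  | succ m ih =>
    unfold splitLoop
    split_ifs with hempty
    · exact hacc.mono Finset.subset_union_left
    · extract_lets r pOut pIn first second p q
      have hr : r ∈ G.verts :=
        resolve_spec (p := (· ∈ G.verts)) (Finset.nonempty_iff_ne_empty.mpr hempty) _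
      have hOut : IsSubPair G pOut := (outSeparator_spec R S hr (by linarith)).isSubPair
      have hIn : IsSubPair G pIn := (inSeparator_spec R S hr (by linarith)).isSubPair
      have hp : IsSubPair G p := by
        simp only [p, first, second]
        split_ifs <;> assumption
      split_ifs with hcard
      · refine (ih (G.remove _) _ _ (disjoint_union_remove hU) ?_).mono (union_remove_subset hp)
        exact hacc.add_recursive hU hp (hrec (G.induce _) _)
      · exact isFinePacking_pruneLoop R (by linarith) hrec r _ G U acc hU hacc

theorem isFinePacking_splitAux (hd : 16 ≤ d) (m : ℕ) (G : NodeGraph α) (S : Finset α) :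
    IsFinePacking G.Adj S d G.verts (splitAux R d m G S).2 := by
  induction m generalizing G S with
  | zero => exact isFinePacking_empty _ _ _ _
  | succ m ih =>
    exact (isFinePacking_splitLoop R hd ih _ _ G ∅ (∅, ∅) (Finset.disjoint_empty_left _)
      (isFinePacking_empty _ _ _ _)).mono (by simp)

theorem isFinePacking_split (hd : 16 ≤ d) (G : NodeGraph α) (S : Finset α) :
    IsFinePacking G.Adj S d G.verts (split R G S d).2 :=
  isFinePacking_splitAux R hd _ G S

end Split

/-! ### One iteration of the while loop on a level -/

section Level

variable {V E : Type*}

theorem mem_flatten {A : Finset (Finset V)} {x : V} : x ∈ flatten A ↔ ∃ B ∈ A, x ∈ B := by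
  simp [flatten, Finset.mem_sup]

theorem flatten_mono {A B : Finset (Finset V)} (h : A ⊆ B) : flatten A ⊆ flatten B :=
  Finset.sup_mono h

theorem eq_of_mem_of_mem {N : Finset (Finset V)} (hN : (N : Set (Finset V)).PairwiseDisjoint id)
    {A B : Finset V} (hA : A ∈ N) (hB : B ∈ N) {x : V} (hxA : x ∈ A) (hxB : x ∈ B) : A = B := by
  by_contra hne
  exact Finset.disjoint_left.mp (hN hA hB hne) hxA hxB

theorem nodeOf_eq {G : NodeGraph (Finset V)} (hG : (G.verts : Set (Finset V)).PairwiseDisjoint id)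
    {A : Finset V} (hA : A ∈ G.verts) {r : V} (hr : r ∈ A) : nodeOf G r = A := by
  have : G.verts.filter (fun A => r ∈ A) = {A} := by
    ext B
    simp only [Finset.mem_filter, Finset.mem_singleton]
    exact ⟨fun h => eq_of_mem_of_mem hG h.1 hA h.2 hr, fun h => h ▸ ⟨hA, hr⟩⟩
  rw [nodeOf, this]
  simp [flatten]

theorem pairwiseDisjoint_image_flatten {N : Finset (Finset V)}
    (hN : (N : Set (Finset V)).PairwiseDisjoint id) {P : Finset (Finset (Finset V))}
    (hP : (P : Set (Finset (Finset V))).PairwiseDisjoint id) (hPN : ∀ Q ∈ P, Q ⊆ N) :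
    ((P.image flatten : Finset (Finset V)) : Set (Finset V)).PairwiseDisjoint id := by
  intro X hX Y hY hne
  obtain ⟨Q, hQ, rfl⟩ := Finset.mem_image.mp hX
  obtain ⟨Q', hQ', rfl⟩ := Finset.mem_image.mp hY
  refine Finset.disjoint_left.mpr fun x hx hx' => ?_
  obtain ⟨A, hA, hxA⟩ := mem_flatten.mp hx
  obtain ⟨B, hB, hxB⟩ := mem_flatten.mp hx'
  obtain rfl := eq_of_mem_of_mem hN (hPN Q hQ hA) (hPN Q' hQ' hB) hxA hxB
  exact Finset.disjoint_left.mp (hP hQ hQ' fun h => hne (by rw [h])) hA hB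

theorem mem_newTrees {roots : RootTable V} {b : ℕ × ℕ} {P : Finset (Finset V)} {σ : GES V} :
    σ ∈ newTrees roots b P ↔ ∃ X, ∃ h : X.Nonempty, X ∈ P ∧
      σ = { verts := X, center := (roots ⟨X, h⟩).1, initSet := X, birth := b } := by
  simp only [newTrees, Finset.mem_image, Finset.mem_subtype, Subtype.exists]
  constructor
  · rintro ⟨X, h, hX, rfl⟩
    exact ⟨X, h, hX, rfl⟩
  · rintro ⟨X, h, hX, rfl⟩
    exact ⟨X, h, hX, rfl⟩

/-- The nodes `D` lie on the tree `τ` and are far from its root. -/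
def IsFarSet (G : NodeGraph (Finset V)) (S : Finset (Finset V)) (δ : ℝ) (τ : GES V)
    (D : Finset (Finset V)) : Prop :=
  D ⊆ (treeGraph G τ).verts ∧ ∀ B ∈ D,
    ¬ Near (treeGraph G τ) ((treeGraph G τ).verts ∩ S) (δ / 2) (nodeOf G τ.center) B

/-- The possible effects of one iteration of the while loop on a level. -/
inductive LevelStep (δ : ℝ) (G : NodeGraph (Finset V)) (S : Finset (Finset V)) (b : ℕ × ℕ)
    (roots : RootTable V) (st : LevelState V) : LevelState V → Prop
  | stay : LevelStep δ G S b roots st st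
  | prune {τ : GES V} {D P : Finset (Finset V)} {sep : Finset V} :
      τ ∈ st.trees → IsFarSet G S δ τ D → (P : Set (Finset V)).PairwiseDisjoint id →
      (∀ X ∈ P, ∃ Q ⊆ D, X = flatten Q) → st.sep ⊆ sep →
      LevelStep δ G S b roots st
        ⟨insert { τ with verts := τ.verts \ flatten D } (st.trees.erase τ) ∪ newTrees roots b P,
          sep, st.deleted⟩
  | restart {τ : GES V} {D P : Finset (Finset V)} {sep : Finset V} :
      τ ∈ st.trees → IsFarSet G S δ τ D → 2 * τ.verts.card < 3 * (flatten D).card →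
      (P : Set (Finset V)).PairwiseDisjoint id →
      (∀ X ∈ P, ∃ Q ⊆ (treeGraph G τ).verts,
        X = flatten Q ∧ Concentrated G.Adj S (δ / 2) Q) → st.sep ⊆ sep →
      LevelStep δ G S b roots st
        ⟨st.trees.erase τ ∪ newTrees roots b P, sep, (τ, P) :: st.deleted⟩

theorem IsFarSet.mono {G : NodeGraph (Finset V)} {S : Finset (Finset V)} {δ : ℝ} {τ : GES V}
    {D D' : Finset (Finset V)} (h : IsFarSet G S δ τ D) (hD : D' ⊆ D) : IsFarSet G S δ τ D' :=
  ⟨hD.trans h.1, fun B hB => h.2 B (hD hB)⟩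

theorem mem_treeGraph_verts {G : NodeGraph (Finset V)} {τ : GES V} {A : Finset V} :
    A ∈ (treeGraph G τ).verts ↔ A ∈ G.verts ∧ A ⊆ τ.verts := by
  simp [treeGraph, NodeGraph.induce, nodesIn]

theorem treeGraph_verts_subset (G : NodeGraph (Finset V)) (τ : GES V) :
    (treeGraph G τ).verts ⊆ G.verts :=
  fun _ hA => (mem_treeGraph_verts.mp hA).1

theorem flatten_treeGraph_verts_subset (G : NodeGraph (Finset V)) (τ : GES V) :
    flatten (treeGraph G τ).verts ⊆ τ.verts := fun _ hx =>
  let ⟨_, hA, hxA⟩ := mem_flatten.mp hx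
  (mem_treeGraph_verts.mp hA).2 hxA

/-- All later arguments use only `LevelStep`, which forgets the rules. The bound on δ gives `Split`
a parameter δ/2 ≥ 16. -/
theorem levelStep_loopBody (R : Rules V) {δ : ℝ} (hδ : 32 ≤ δ) {G : NodeGraph (Finset V)}
    (hG : (G.verts : Set (Finset V)).PairwiseDisjoint id) (S : Finset (Finset V)) (b : ℕ × ℕ)
    (roots : RootTable V) (st : LevelState V) :
    LevelStep δ G S b roots st (loopBody R δ G S b roots st) := by
  unfold loopBody
  split_ifs with hex
  · extract_lets τ H r T B p q P q' P'
    obtain ⟨hτ, hfar⟩ : τ ∈ st.trees ∧ HasFar G S δ τ :=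
      resolve_spec (p := fun τ => τ ∈ st.trees ∧ HasFar G S δ τ) (by simpa using hex) _
    have hH : (H.verts : Set (Finset V)).PairwiseDisjoint id :=
      hG.subset (Finset.coe_subset.mpr (treeGraph_verts_subset G τ))
    have hB : IsFar H T r δ B := resolve_spec hfar _
    obtain ⟨hp, hpfar⟩ := farSeparator_spec R.toSubRules hB (by linarith)
    have hD : IsFarSet G S δ τ (p.1 ∪ p.2) :=
      ⟨Finset.union_subset hp.1 hp.2.1, fun B hB => hpfar B (Finset.mem_union.mp hB)⟩
    split_ifs with hcard
    -- The new parts before flattening, as sets of nodes: each separator node becomes a one-element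
    -- set, so flattening K gives P.
    · let K : Finset (Finset (Finset V)) := q.2 ∪ p.1.image fun A => {A}
      have hpack : IsFinePacking H.Adj T (δ / 2) _ K :=
        (isFinePacking_empty H.Adj T (δ / 2) ∅).add_separator
          (Finset.disjoint_empty_left _) hp
          (isFinePacking_split R.toSubRules (by linarith) (H.induce p.2) (p.2 ∩ T))
          (fun _ hA => (NodeGraph.mem_induce_verts.mp hA).2) (fun x hx hS => Finset.mem_inter.mpr ⟨hx, hS⟩) fun X hX => by
            simpa only [K, Finset.mem_union, Finset.mem_image, eq_comm] using Or.inr hX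
      have hKD : ∀ Q ∈ K, Q ⊆ p.1 ∪ p.2 := fun Q hQ B hB => by
        simpa using hpack.subset Q hQ hB
      have hP : K.image flatten = P := by
        rw [Finset.image_union, Finset.image_image]
        congr 1
        ext A
        simp [flatten]
      refine .prune hτ hD ?_ ?_ Finset.subset_union_left
      · rw [← hP]
        refine pairwiseDisjoint_image_flatten hH hpack.disjoint fun Q hQ => ?_
        exact (hKD Q hQ).trans hD.1
      · rw [← hP]
        intro X hX
        obtain ⟨Q, hQ, rfl⟩ := Finset.mem_image.mp hX
        exact ⟨Q, hKD Q hQ, rfl⟩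
    · have hpack := isFinePacking_split R.toSubRules (d := δ / 2) (by linarith) H T
      -- Here the far set is the V-part alone, since the failed size test speaks about it.
      refine .restart hτ (hD.mono Finset.subset_union_right) (not_le.mp hcard) ?_ ?_
        Finset.subset_union_left
      · exact pairwiseDisjoint_image_flatten hH hpack.disjoint hpack.subset
      · intro X hX
        obtain ⟨Q, hQ, rfl⟩ := Finset.mem_image.mp hX
        refine ⟨Q, hpack.subset Q hQ, rfl, (hpack.concentrated Q hQ).of_subset ?_⟩
        exact fun B hB hS => Finset.mem_inter.mpr ⟨hpack.subset Q hQ hB, hS⟩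
  · exact .stay

/-! ### Refinement of the levels -/

/-- The trees of `st` run on pairwise disjoint sets. -/
def TreesDisjoint (st : LevelState V) : Prop :=
  (st.trees : Set (GES V)).PairwiseDisjoint GES.verts

/-- The trees of `st'` refine those of `st`, and the separator has only grown. -/
def StateRefines (st' st : LevelState V) : Prop :=
  (∀ σ ∈ st'.trees, ∃ τ ∈ st.trees, σ.verts ⊆ τ.verts) ∧ st.sep ⊆ st'.sep

theorem StateRefines.refl (st : LevelState V) : StateRefines st st :=
  ⟨fun σ h => ⟨σ, h, subset_rfl⟩, subset_rfl⟩

theorem StateRefines.trans {st st' st'' : LevelState V} (h : StateRefines st'' st')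
    (h' : StateRefines st' st) : StateRefines st'' st := by
  refine ⟨fun σ hσ => ?_, h'.2.trans h.2⟩
  obtain ⟨τ, hτ, hs⟩ := h.1 σ hσ
  obtain ⟨τ', hτ', hs'⟩ := h'.1 τ hτ
  exact ⟨τ', hτ', hs.trans hs'⟩

theorem pairwiseDisjoint_newTrees (roots : RootTable V) (b : ℕ × ℕ) {P : Finset (Finset V)}
    (hP : (P : Set (Finset V)).PairwiseDisjoint id) :
    (newTrees roots b P : Set (GES V)).PairwiseDisjoint GES.verts := by
  intro σ hσ σ' hσ' hne
  obtain ⟨X, h, hX, rfl⟩ := mem_newTrees.mp hσ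
  obtain ⟨Y, h', hY, rfl⟩ := mem_newTrees.mp hσ'
  exact hP hX hY fun hXY => hne (by subst hXY; rfl)

variable {δ : ℝ} {G : NodeGraph (Finset V)} {S : Finset (Finset V)} {b : ℕ × ℕ}
  {roots : RootTable V} {st st' : LevelState V}

theorem TreesDisjoint.replace {τ : GES V} (h : TreesDisjoint st) (hτ : τ ∈ st.trees)
    {K : Finset (GES V)} (hK : (K : Set (GES V)).PairwiseDisjoint GES.verts)
    (hKτ : ∀ σ ∈ K, σ.verts ⊆ τ.verts) :
    ((st.trees.erase τ ∪ K : Finset (GES V)) : Set (GES V)).PairwiseDisjoint GES.verts := by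
  rw [Finset.coe_union]
  refine Set.PairwiseDisjoint.union (h.subset (Finset.coe_subset.mpr (Finset.erase_subset _ _))) hK
    fun σ hσ σ' hσ' _ => ?_
  obtain ⟨hne, hσ⟩ := Finset.mem_erase.mp hσ
  exact (h hσ hτ hne).mono_right (hKτ σ' hσ')

theorem stateRefines_replace {τ : GES V} (hτ : τ ∈ st.trees) {K : Finset (GES V)}
    (hKτ : ∀ σ ∈ K, σ.verts ⊆ τ.verts) {sep : Finset V} (hsep : st.sep ⊆ sep)
    (l : List (GES V × Finset (Finset V))) :
    StateRefines ⟨st.trees.erase τ ∪ K, sep, l⟩ st := by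
  refine ⟨fun σ hσ => ?_, hsep⟩
  rcases Finset.mem_union.mp hσ with hσ | hσ
  · exact ⟨σ, (Finset.mem_erase.mp hσ).2, subset_rfl⟩
  · exact ⟨τ, hτ, hKτ σ hσ⟩

/-- In both cases one tree is replaced by trees on pairwise disjoint subsets of its vertex set. -/
theorem LevelStep.treesDisjoint_and_refines (hs : LevelStep δ G S b roots st st')
    (h : TreesDisjoint st) : TreesDisjoint st' ∧ StateRefines st' st := by
  cases hs with
  | stay => exact ⟨h, .refl st⟩
  | @prune τ D P sep hτ hD hP hPD hsep =>
    set τ' : GES V := { τ with verts := τ.verts \ flatten D } with hτ'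
    have hsub : ∀ σ ∈ newTrees roots b P, σ.verts ⊆ flatten D := by
      intro σ hσ
      obtain ⟨X, hne, hX, rfl⟩ := mem_newTrees.mp hσ
      obtain ⟨Q, hQ, hXQ⟩ := hPD X hX
      exact (le_of_eq hXQ).trans (flatten_mono hQ)
    have hDτ : flatten D ⊆ τ.verts :=
      (flatten_mono hD.1).trans (flatten_treeGraph_verts_subset G τ)
    have hK : ((insert τ' (newTrees roots b P) : Finset (GES V)) : Set (GES V)).PairwiseDisjoint
        GES.verts := by
      rw [Finset.coe_insert]
      refine (pairwiseDisjoint_newTrees roots b hP).insert fun σ hσ _ => ?_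
      exact Finset.sdiff_disjoint.mono_right (hsub σ hσ)
    have hKτ : ∀ σ ∈ insert τ' (newTrees roots b P), σ.verts ⊆ τ.verts := by
      intro σ hσ
      rcases Finset.mem_insert.mp hσ with rfl | hσ
      · exact Finset.sdiff_subset
      · exact (hsub σ hσ).trans hDτ
    rw [Finset.insert_union, ← Finset.union_insert]
    exact ⟨h.replace hτ hK hKτ, stateRefines_replace hτ hKτ hsep _⟩
  | @restart τ D P sep hτ hD hcard hP hPQ hsep =>
    have hKτ : ∀ σ ∈ newTrees roots b P, σ.verts ⊆ τ.verts := by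
      intro σ hσ
      obtain ⟨X, hne, hX, rfl⟩ := mem_newTrees.mp hσ
      obtain ⟨Q, hQ, hXQ, -⟩ := hPQ X hX
      exact (le_of_eq hXQ).trans ((flatten_mono hQ).trans (flatten_treeGraph_verts_subset G τ))
    exact ⟨h.replace hτ (pairwiseDisjoint_newTrees roots b hP) hKτ,
      stateRefines_replace hτ hKτ hsep _⟩

/-! ### Containment in the initial set -/

/-- Trees and the partitions computed upon their deletion stay inside the initial set. -/
def InitBounded (st : LevelState V) : Prop :=
  (∀ τ ∈ st.trees, τ.verts ⊆ τ.initSet) ∧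
    ∀ τ P, (τ, P) ∈ st.deleted → ∀ X ∈ P, X ⊆ τ.initSet

theorem LevelStep.initBounded (hs : LevelStep δ G S b roots st st') (h : InitBounded st) :
    InitBounded st' := by
  have hnew : ∀ P, ∀ σ ∈ newTrees roots b P, σ.verts ⊆ σ.initSet := by
    intro P σ hσ
    obtain ⟨X, hne, hX, rfl⟩ := mem_newTrees.mp hσ
    exact subset_rfl
  cases hs with
  | stay => exact h
  | @prune τ D P sep hτ hD hP hPD hsep =>
    refine ⟨fun σ hσ => ?_, h.2⟩
    simp only [Finset.mem_union, Finset.mem_insert] at hσ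
    rcases hσ with (rfl | hσ) | hσ
    · exact Finset.sdiff_subset.trans (h.1 τ hτ)
    · exact h.1 σ (Finset.mem_erase.mp hσ).2
    · exact hnew P σ hσ
  | @restart τ D P sep hτ hD hcard hP hPQ hsep =>
    refine ⟨fun σ hσ => ?_, fun σ P' hσ X hX => ?_⟩
    · rcases Finset.mem_union.mp hσ with hσ | hσ
      · exact h.1 σ (Finset.mem_erase.mp hσ).2
      · exact hnew P σ hσ
    · rcases List.mem_cons.mp hσ with heq | hσ
      · obtain ⟨rfl, rfl⟩ := Prod.mk.inj heq
        obtain ⟨Q, hQ, hXQ, -⟩ := hPQ X hX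
        exact (le_of_eq hXQ).trans
          (((flatten_mono hQ).trans (flatten_treeGraph_verts_subset G _)).trans (h.1 _ hτ))
      · exact h.2 σ P' hσ X hX

/-! ### A concentrated set protects the trees rooted in it -/

/-- Every tree started on `Y` at moment `b` has its root in `X` and contains all nodes that meet
`X`; no such tree has been deleted as a whole. -/
structure Shielded (N : Finset (Finset V)) (X Y : Finset V) (b : ℕ × ℕ) (st : LevelState V) :
    Prop where
  center_mem : ∀ τ ∈ st.trees, τ.initSet = Y → τ.birth = b → τ.center ∈ X
  node_subset : ∀ τ ∈ st.trees, τ.initSet = Y → τ.birth = b →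
    ∀ A ∈ N, ¬ Disjoint A X → A ⊆ τ.verts
  not_deleted : ∀ τ P, (τ, P) ∈ st.deleted → τ.initSet = Y → τ.birth ≠ b

/-- Carries the invariant from one deletion to the next, between which the lower levels refine the
nodes. -/
theorem Shielded.refine {N N' : Finset (Finset V)} {X Y : Finset V}
    (h : Shielded N X Y b st) (hN : ∀ A ∈ N', ∃ B ∈ N, A ⊆ B) : Shielded N' X Y b st := by
  refine ⟨h.center_mem, fun τ hτ hY hb A hA hAX => ?_, h.not_deleted⟩
  obtain ⟨B, hB, hAB⟩ := hN A hA
  exact hAB.trans (h.node_subset τ hτ hY hb B hB fun hBX => hAX (hBX.mono_left hAB))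

theorem shielded_newTree {N Q : Finset (Finset V)} (hN : (N : Set (Finset V)).PairwiseDisjoint id)
    (hQ : Q ⊆ N) {X A : Finset V} (hX : X ⊆ flatten Q) (hA : A ∈ N) (hAX : ¬ Disjoint A X) :
    A ⊆ flatten Q := by
  obtain ⟨x, hxA, hxX⟩ := Finset.not_disjoint_iff.mp hAX
  obtain ⟨B, hB, hxB⟩ := mem_flatten.mp (hX hxX)
  obtain rfl := eq_of_mem_of_mem hN hA (hQ hB) hxA hxB
  exact Finset.le_sup (f := id) hB

/-- All nodes that meet `X` are near the root of any tree that contains these nodes and is rooted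
in `X`. -/
def IsShield (δ : ℝ) (G : NodeGraph (Finset V)) (S : Finset (Finset V)) (X : Finset V) : Prop :=
  (∀ x ∈ X, ∃ A ∈ G.verts, x ∈ A) ∧
  ∀ τ : GES V, τ.center ∈ X → (∀ A ∈ G.verts, ¬ Disjoint A X → A ⊆ τ.verts) →
    ∀ B ∈ G.verts, ¬ Disjoint B X →
      Near (treeGraph G τ) ((treeGraph G τ).verts ∩ S) (δ / 2) (nodeOf G τ.center) B

theorem IsShield.disjoint_flatten {X : Finset V} (hX : IsShield δ G S X) {τ : GES V}
    (hc : τ.center ∈ X) (hn : ∀ A ∈ G.verts, ¬ Disjoint A X → A ⊆ τ.verts)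
    {D : Finset (Finset V)} (hD : IsFarSet G S δ τ D) : Disjoint (flatten D) X := by
  refine Finset.disjoint_left.mpr fun x hx hxX => ?_
  obtain ⟨B, hB, hxB⟩ := mem_flatten.mp hx
  exact hD.2 B hB (hX.2 τ hc hn B (treeGraph_verts_subset G τ (hD.1 hB))
    (Finset.not_disjoint_iff.mpr ⟨x, hxB, hxX⟩))

/-- Far sets miss X, so pruning takes no node that meets X, and a restart would need more room than
Y has. A tree newly started on Y consists of whole nodes and contains X, and its root lies in X by
`hroot`. -/
theorem LevelStep.shielded {b' : ℕ × ℕ} {X Y : Finset V}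
    (hs : LevelStep δ G S b' roots st st')
    (hG : (G.verts : Set (Finset V)).PairwiseDisjoint id) (hX : IsShield δ G S X) (hXY : X ⊆ Y)
    (hcard : 2 * Y.card < 3 * X.card) (hroot : b' = b → ∀ h, (roots ⟨Y, h⟩).1 ∈ X)
    (hbd : InitBounded st) (h : Shielded G.verts X Y b st) : Shielded G.verts X Y b st' := by
  have hnew : ∀ P : Finset (Finset V), (∀ Z ∈ P, ∃ Q ⊆ G.verts, Z = flatten Q) →
      ∀ σ ∈ newTrees roots b' P, σ.initSet = Y → σ.birth = b → σ.center ∈ X ∧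
        ∀ A ∈ G.verts, ¬ Disjoint A X → A ⊆ σ.verts := by
    intro P hP σ hσ hY hb
    obtain ⟨Z, hne, hZ, rfl⟩ := mem_newTrees.mp hσ
    simp only at hY hb
    subst hY
    refine ⟨hroot hb hne, fun A hA hAX => ?_⟩
    obtain ⟨Q, hQ, rfl⟩ := hP Z hZ
    exact shielded_newTree hG hQ hXY hA hAX
  cases hs with
  | stay => exact h
  | @prune τ D P sep hτ hD hP hPD hsep =>
    have hnewP := hnew P fun Z hZ =>
      let ⟨Q, hQ, hZQ⟩ := hPD Z hZ
      ⟨Q, (hQ.trans hD.1).trans (treeGraph_verts_subset G τ), hZQ⟩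
    refine ⟨fun σ hσ hY hb => ?_, fun σ hσ hY hb A hA hAX => ?_, h.not_deleted⟩
    · simp only [Finset.mem_union, Finset.mem_insert] at hσ
      rcases hσ with (rfl | hσ) | hσ
      · exact h.center_mem τ hτ hY hb
      · exact h.center_mem σ (Finset.mem_erase.mp hσ).2 hY hb
      · exact (hnewP σ hσ hY hb).1
    · simp only [Finset.mem_union, Finset.mem_insert] at hσ
      rcases hσ with (rfl | hσ) | hσ
      -- Whole nodes are removed, so a node that loses a vertex belongs to the far set, and then it
      -- misses X.
      · refine Finset.subset_sdiff.mpr ⟨h.node_subset τ hτ hY hb A hA hAX, ?_⟩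
        refine Finset.disjoint_left.mpr fun x hxA hx => ?_
        obtain ⟨B, hB, hxB⟩ := mem_flatten.mp hx
        obtain rfl := eq_of_mem_of_mem hG hA (treeGraph_verts_subset G τ (hD.1 hB)) hxA hxB
        exact hAX ((hX.disjoint_flatten (h.center_mem τ hτ hY hb)
          (h.node_subset τ hτ hY hb) hD).mono_left (Finset.le_sup (f := id) hB))
      · exact h.node_subset σ (Finset.mem_erase.mp hσ).2 hY hb A hA hAX
      · exact (hnewP σ hσ hY hb).2 A hA hAX
  | @restart τ D P sep hτ hD hcardD hP hPQ hsep =>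
    have hnewP := hnew P fun Z hZ =>
      let ⟨Q, hQ, hZQ, _⟩ := hPQ Z hZ
      ⟨Q, hQ.trans (treeGraph_verts_subset G τ), hZQ⟩
    refine ⟨fun σ hσ hY hb => ?_, fun σ hσ hY hb => ?_, fun σ P' hσ hY hb => ?_⟩
    · rcases Finset.mem_union.mp hσ with hσ | hσ
      · exact h.center_mem σ (Finset.mem_erase.mp hσ).2 hY hb
      · exact (hnewP σ hσ hY hb).1
    · rcases Finset.mem_union.mp hσ with hσ | hσ
      · exact h.node_subset σ (Finset.mem_erase.mp hσ).2 hY hb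
      · exact (hnewP σ hσ hY hb).2
    · rcases List.mem_cons.mp hσ with heq | hσ
      · obtain ⟨rfl, rfl⟩ := Prod.mk.inj heq
        have hn := h.node_subset σ hτ hY hb
        have hdisj := hX.disjoint_flatten (h.center_mem σ hτ hY hb) hn hD
        have hXσ : X ⊆ σ.verts := fun x hx =>
          let ⟨A, hA, hxA⟩ := hX.1 x hx
          hn A hA (Finset.not_disjoint_iff.mpr ⟨x, hxA, hx⟩) hxA
        -- The far set has more than 2/3 of the current vertices, and X has more than 2/3 of Y,
        -- which contains them; both are disjoint subsets of the tree.
        have h1 := Finset.card_le_card (Finset.union_subset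
          ((flatten_mono hD.1).trans (flatten_treeGraph_verts_subset G σ)) hXσ)
        rw [Finset.card_union_of_disjoint hdisj] at h1
        have h2 := Finset.card_le_card (hY ▸ hbd.1 σ hτ)
        omega
      · exact h.not_deleted σ P' hσ hY hb

/-- Primed data are later. Sending each later node to the earlier node containing it maps walks
inside Q to walks in the earlier tree without lengthening them. Two radii of δ/4 through the centre
ρ give δ/2. -/
theorem Concentrated.isShield {src tgt : E → V} {F F' : Finset E} {N N' : Finset (Finset V)}
    {s s' : Finset V} {Q : Finset (Finset V)} (hF : F' ⊆ F)
    (hN : (N : Set (Finset V)).PairwiseDisjoint id) (hNN' : ∀ A ∈ N', ∃ B ∈ N, A ⊆ B)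
    (hs : s ⊆ s') (hQ : Q ⊆ N')
    (h : Concentrated (levelGraph src tgt F' N').Adj (singletons s') (δ / 2) Q) :
    IsShield δ (levelGraph src tgt F N) (singletons s) (flatten Q) := by
  set G := levelGraph src tgt F N
  choose! f hfN hf using fun A hA => hNN' A (hQ hA)
  refine ⟨fun x hx => ?_, fun τ hc hn B hB hBX => ?_⟩
  · obtain ⟨A, hA, hxA⟩ := mem_flatten.mp hx
    exact ⟨f A, hfN A hA, hf A hA hxA⟩
  obtain ⟨A, hA, hrA⟩ := mem_flatten.mp hc
  obtain ⟨x, hxB, hx⟩ := Finset.not_disjoint_iff.mp hBX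
  obtain ⟨C, hC, hxC⟩ := mem_flatten.mp hx
  rw [nodeOf_eq (G := G) hN (hfN A hA) (hf A hA hrA)]
  obtain rfl : f C = B := eq_of_mem_of_mem hN (hfN C hC) hB (hf C hC hxC) hxB
  obtain ⟨ρ, hρ⟩ := h
  have key : ∀ A₁ ∈ Q, ∀ A₂ ∈ Q, A₁.Nonempty →
      AtMost ((treeGraph G τ).sdist ((treeGraph G τ).verts ∩ singletons s) (f A₁) (f A₂))
        (δ / 2) := by
    intro A₁ hA₁ A₂ hA₂ hne
    obtain ⟨k, hk, hw⟩ := atMost_sdist.mp ((hρ A₁ hA₁).2.sdist_trans (hρ A₂ hA₂).1)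
    -- Nonemptiness of nodes is not among the invariants; along a walk the edges supply it.
    have hne' : ∀ a b, (levelGraph src tgt F' N').Adj a b → b.Nonempty :=
      fun a b ⟨e, _, _, he⟩ => ⟨_, he⟩
    have hadj : ∀ a ∈ Q, ∀ b ∈ Q, (levelGraph src tgt F' N').Adj a b →
        (treeGraph G τ).Adj (f a) (f b) := by
      rintro a ha b hb ⟨e, he, hea, heb⟩
      exact ⟨e, hF he, hf a ha hea, hf b hb heb⟩
    have hverts : ∀ a ∈ Q, a.Nonempty → f a ∈ (treeGraph G τ).verts := by
      rintro a ha ⟨y, hy⟩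
      refine mem_treeGraph_verts.mpr ⟨hfN a ha, hn _ (hfN a ha) ?_⟩
      exact Finset.not_disjoint_iff.mpr ⟨y, hf a ha hy, mem_flatten.mpr ⟨a, ha, hy⟩⟩
    -- A node that contains the tail of an edge and lies inside a singleton equals it. So a vertex
    -- counted in the image was already counted before.
    have hsep : ∀ a ∈ Q, ∀ b, (levelGraph src tgt F' N').Adj a b →
        f a ∈ (treeGraph G τ).verts ∩ singletons s → a ∈ singletons s' := by
      rintro a ha b ⟨e, he, hea, heb⟩ hfa
      obtain ⟨y, hy, hya⟩ := Finset.mem_image.mp (Finset.mem_inter.mp hfa).2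
      have hsub : a ⊆ {y} := hya ▸ hf a ha
      refine Finset.mem_image.mpr ⟨y, hs hy, ?_⟩
      exact ((Finset.Nonempty.subset_singleton_iff ⟨_, hea⟩).mp hsub).symm
    obtain ⟨l, hl, hw'⟩ := NodeGraph.SWalk.map (G := ⟨Q, (levelGraph src tgt F' N').Adj⟩)
      f Finset.Nonempty hne' hverts hadj hsep hw hne
    exact atMost_sdist.mpr ⟨l, hl.trans hk, hw'⟩
  exact ⟨key A hA C hC ⟨_, hrA⟩, key C hC A hA ⟨_, hxC⟩⟩

end Level

/-! ### Whole runs and the comparison of different roots -/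

section Run

theorem foldl_range_induction {σ : Type*} {f : σ → ℕ → σ} {M : σ → Prop} {s : σ} (n : ℕ)
    (h0 : M s) (hstep : ∀ s c, M s → M (f s c)) : M ((List.range n).foldl f s) := by
  induction n with
  | zero => exact h0
  | succ n ih =>
    rw [List.range_succ, List.foldl_append]
    exact hstep _ _ ih

/-- The nodes on a level are always pairwise disjoint, they are only ever refined, and the separator
only grows. -/
structure GoodInput {V : Type*} (inp : ℕ → LevelInput V) : Prop where
  disjoint : ∀ t, ((inp t).nodes : Set (Finset V)).PairwiseDisjoint id
  refines_succ : ∀ t, ∀ A ∈ (inp (t + 1)).nodes, ∃ B ∈ (inp t).nodes, A ⊆ B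
  sep_succ : ∀ t, (inp t).sep ⊆ (inp (t + 1)).sep

theorem GoodInput.refines {V : Type*} {inp : ℕ → LevelInput V} (h : GoodInput inp) {t t' : ℕ}
    (ht : t ≤ t') : ∀ A ∈ (inp t').nodes, ∃ B ∈ (inp t).nodes, A ⊆ B := by
  induction t', ht using Nat.le_induction with
  | base => exact fun A hA => ⟨A, hA, subset_rfl⟩
  | succ t' _ ih =>
    intro A hA
    obtain ⟨B, hB, hAB⟩ := h.refines_succ t' A hA
    obtain ⟨C, hC, hBC⟩ := ih B hB
    exact ⟨C, hC, hAB.trans hBC⟩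

theorem GoodInput.sep_mono {V : Type*} {inp : ℕ → LevelInput V} (h : GoodInput inp) :
    Monotone fun t => (inp t).sep :=
  monotone_nat_of_le_succ h.sep_succ

variable {V E : Type*} [Fintype V] {src tgt : E → V} {edges : ℕ → Finset E} {δ : ℝ}
  {R : ℕ → ℕ → Rules V} {roots : ℕ → ℕ → RootTable V} {inp : ℕ → LevelInput V}

theorem levelRun_zero (hδ : 32 ≤ δ) (hinp : GoodInput inp) :
    ∃ P : Finset (Finset V), ∃ sep, (P : Set (Finset V)).PairwiseDisjoint id ∧
      (∀ X ∈ P, ∃ Q ⊆ (inp 0).nodes, X = flatten Q) ∧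
      levelRun src tgt edges δ R roots inp 0 = ⟨newTrees (roots 0 0) (0, 0) P, sep, []⟩ := by
  have hpack := isFinePacking_split (R 0 0).toSubRules (d := δ / 2) (by linarith)
    (levelGraph src tgt (edges 0) (inp 0).nodes) (singletons (inp 0).sep)
  refine ⟨_, _, pairwiseDisjoint_image_flatten (hinp.disjoint 0) hpack.disjoint hpack.subset,
    fun X hX => ?_, rfl⟩
  obtain ⟨Q, hQ, rfl⟩ := Finset.mem_image.mp hX
  exact ⟨Q, hpack.subset Q hQ, rfl⟩

theorem levelRun_succ_induction (hδ : 32 ≤ δ) (hinp : GoodInput inp) {M : LevelState V → Prop}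
    (t : ℕ) (h0 : M (levelRun src tgt edges δ R roots inp t))
    (hstep : ∀ c st st', M st →
      LevelStep δ (levelGraph src tgt (edges (t + 1)) (inp (t + 1)).nodes)
        (singletons (inp (t + 1)).sep) (t + 1, c) (roots (t + 1) c) st st' → M st') :
    M (levelRun src tgt edges δ R roots inp (t + 1)) :=
  foldl_range_induction _ h0 fun st c hst =>
    hstep c st _ hst (levelStep_loopBody _ hδ (hinp.disjoint (t + 1)) _ _ _ _)

theorem treesDisjoint_levelRun (hδ : 32 ≤ δ) (hinp : GoodInput inp) (t : ℕ) :
    TreesDisjoint (levelRun src tgt edges δ R roots inp t) := by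
  induction t with
  | zero =>
    obtain ⟨P, sep, hP, -, h⟩ := levelRun_zero (src := src) (tgt := tgt) (edges := edges) (R := R)
      (roots := roots) hδ hinp
    rw [h]
    exact pairwiseDisjoint_newTrees _ _ hP
  | succ t ih =>
    exact levelRun_succ_induction hδ hinp t ih fun c st st' hst hs =>
      (hs.treesDisjoint_and_refines hst).1

theorem stateRefines_levelRun_succ (hδ : 32 ≤ δ) (hinp : GoodInput inp) (t : ℕ) :
    StateRefines (levelRun src tgt edges δ R roots inp (t + 1))
      (levelRun src tgt edges δ R roots inp t) :=
  (levelRun_succ_induction (M := fun st => TreesDisjoint st ∧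
      StateRefines st (levelRun src tgt edges δ R roots inp t)) hδ hinp t
    ⟨treesDisjoint_levelRun hδ hinp t, .refl _⟩ fun _ _ _ hst hs =>
      have h := hs.treesDisjoint_and_refines hst.1
      ⟨h.1, h.2.trans hst.2⟩).2

theorem initBounded_levelRun (hδ : 32 ≤ δ) (hinp : GoodInput inp) (t : ℕ) :
    InitBounded (levelRun src tgt edges δ R roots inp t) := by
  induction t with
  | zero =>
    obtain ⟨P, sep, -, -, h⟩ := levelRun_zero (src := src) (tgt := tgt) (edges := edges) (R := R)
      (roots := roots) hδ hinp
    rw [h]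
    refine ⟨fun σ hσ => ?_, fun τ P h => absurd h List.not_mem_nil⟩
    obtain ⟨X, hne, hX, rfl⟩ := mem_newTrees.mp hσ
    exact subset_rfl
  | succ t ih =>
    exact levelRun_succ_induction hδ hinp t ih fun c st st' hst hs => hs.initBounded hst

/-- The graph and the separator set of the level stay fixed throughout the while loop, so it is
irrelevant in which iteration the entry was added. -/
theorem deleted_levelRun_succ (hδ : 32 ≤ δ) (hinp : GoodInput inp) (t : ℕ) {τ : GES V}
    {P : Finset (Finset V)} (h : (τ, P) ∈ (levelRun src tgt edges δ R roots inp (t + 1)).deleted) :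
    (τ, P) ∈ (levelRun src tgt edges δ R roots inp t).deleted ∨
      ∀ X ∈ P, ∃ Q ⊆ (inp (t + 1)).nodes, X = flatten Q ∧
        Concentrated (levelGraph src tgt (edges (t + 1)) (inp (t + 1)).nodes).Adj
          (singletons (inp (t + 1)).sep) (δ / 2) Q := by
  revert h
  refine levelRun_succ_induction (M := fun st => (τ, P) ∈ st.deleted → _) hδ hinp t Or.inl
    fun _ _ _ hst hs => ?_
  cases hs with
  | stay => exact hst
  | prune => exact hst
  | @restart τ' D P' sep hτ hD hcard hP hPQ hsep =>
    intro h
    rcases List.mem_cons.mp h with heq | h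
    · obtain ⟨rfl, rfl⟩ := Prod.mk.inj heq
      refine Or.inr fun X hX => ?_
      obtain ⟨Q, hQ, hXQ, hc⟩ := hPQ X hX
      exact ⟨Q, hQ.trans (treeGraph_verts_subset _ _), hXQ, hc⟩
    · exact hst h

/-- Q may stem from a run with another root: the hypotheses on it involve only the input and the
edges at time T, which the runs share. It protects X at all times up to T, deletion T included. -/
theorem shielded_levelRun (hδ : 32 ≤ δ) (hinp : GoodInput inp) (hedges : Antitone edges)
    {t c T : ℕ} {Y : Finset V} {Q : Finset (Finset V)} (hQ : Q ⊆ (inp T).nodes)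
    (hconc : Concentrated (levelGraph src tgt (edges T) (inp T).nodes).Adj
      (singletons (inp T).sep) (δ / 2) Q)
    (hQY : flatten Q ⊆ Y) (hcard : 2 * Y.card < 3 * (flatten Q).card)
    (hroot : ∀ h, (roots t c ⟨Y, h⟩).1 ∈ flatten Q) {t' : ℕ} (ht' : t' ≤ T) :
    Shielded (inp t').nodes (flatten Q) Y (t, c) (levelRun src tgt edges δ R roots inp t') := by
  induction t' with
  | zero =>
    obtain ⟨P, sep, -, hPQ, h⟩ := levelRun_zero (src := src) (tgt := tgt) (edges := edges) (R := R)
      (roots := roots) hδ hinp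
    rw [h]
    refine ⟨fun σ hσ hY hb => ?_, fun σ hσ hY hb A hA hAX => ?_,
      fun τ P h => absurd h List.not_mem_nil⟩
    · obtain ⟨X, hne, hX, rfl⟩ := mem_newTrees.mp hσ
      obtain ⟨rfl, rfl⟩ := Prod.mk.inj hb
      simp only at hY
      subst hY
      exact hroot hne
    · obtain ⟨X, hne, hX, rfl⟩ := mem_newTrees.mp hσ
      simp only at hY
      subst hY
      obtain ⟨Q', hQ', rfl⟩ := hPQ X hX
      exact shielded_newTree (hinp.disjoint 0) hQ' hQY hA hAX
  | succ n ih =>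
    refine (levelRun_succ_induction (M := fun st => InitBounded st ∧
      Shielded (inp (n + 1)).nodes (flatten Q) Y (t, c) st) hδ hinp n
      ⟨initBounded_levelRun hδ hinp n, (ih (by omega)).refine (hinp.refines_succ n)⟩
      fun c' st st' hst hs => ⟨hs.initBounded hst.1, ?_⟩).2
    refine hs.shielded (hinp.disjoint (n + 1)) ?_ hQY hcard ?_ hst.1 hst.2
    · exact hconc.isShield (hedges ht') (hinp.disjoint _) (hinp.refines ht') (hinp.sep_mono ht') hQ
    · intro hb
      obtain ⟨rfl, rfl⟩ := Prod.mk.inj hb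
      exact hroot

/-- Before the state `st`, some tree started on `Y` at the moment `b` was deleted as a whole while
`Split` returned a part that is large compared with `Y`. -/
def BadDeletion (Y : Finset V) (b : ℕ × ℕ) (st : LevelState V) : Prop :=
  ∃ τ P, (τ, P) ∈ st.deleted ∧ τ.initSet = Y ∧ τ.birth = b ∧
    ∃ X ∈ P, 2 * Y.card < 3 * X.card

theorem exists_concentrated_of_badDeletion (hδ : 32 ≤ δ) (hinp : GoodInput inp) {Y : Finset V}
    {b : ℕ × ℕ} {T : ℕ} (h : BadDeletion Y b (levelRun src tgt edges δ R roots inp (T + 1)))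
    (hT : ¬ BadDeletion Y b (levelRun src tgt edges δ R roots inp T)) :
    ∃ Q ⊆ (inp (T + 1)).nodes,
      Concentrated (levelGraph src tgt (edges (T + 1)) (inp (T + 1)).nodes).Adj
        (singletons (inp (T + 1)).sep) (δ / 2) Q ∧
      flatten Q ⊆ Y ∧ 2 * Y.card < 3 * (flatten Q).card := by
  obtain ⟨τ, P, hτ, rfl, hb, X, hX, hcard⟩ := h
  rcases deleted_levelRun_succ hδ hinp T hτ with h | h
  · exact absurd ⟨τ, P, h, rfl, hb, X, hX, hcard⟩ hT
  · obtain ⟨Q, hQ, rfl, hc⟩ := h X hX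
    exact ⟨Q, hQ, hc, (initBounded_levelRun hδ hinp (T + 1)).2 τ P hτ _ hX, hcard⟩

/-- At most a third of the possible roots of a tree lead to a bad deletion. -/
theorem card_bad_roots (hδ : 32 ≤ δ) (hinp : GoodInput inp) (hedges : Antitone edges)
    (t c T : ℕ) (Y : Finset V) (ρ : {x // x ∈ Y} → ℕ → ℕ → RootTable V)
    (hρ : ∀ x h, (ρ x t c ⟨Y, h⟩).1 = x.1) :
    3 * (Finset.univ.filter fun x =>
      BadDeletion Y (t, c) (levelRun src tgt edges δ R (ρ x) inp T)).card ≤ Y.card := by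
  set bad := Finset.univ.filter fun x => BadDeletion Y (t, c) (levelRun src tgt edges δ R (ρ x) inp T)
  rcases bad.eq_empty_or_nonempty with hbad | hbad
  · simp [hbad]
  have hex : ∀ x ∈ bad, ∃ n, BadDeletion Y (t, c) (levelRun src tgt edges δ R (ρ x) inp n) :=
    fun x hx => ⟨T, (Finset.mem_filter.mp hx).2⟩
  -- For each bad root, the number of the deletion during which its first bad event happens.
  choose! time htime hmin using fun x hx =>
    (⟨Nat.find (hex x hx), Nat.find_spec (hex x hx), fun m => Nat.find_min (hex x hx)⟩ :
      ∃ n, BadDeletion Y (t, c) (levelRun src tgt edges δ R (ρ x) inp n) ∧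
        ∀ m < n, ¬ BadDeletion Y (t, c) (levelRun src tgt edges δ R (ρ x) inp m))
  obtain ⟨z, hz, hmax⟩ := bad.exists_max_image time hbad
  -- Preprocessing deletes no tree.
  obtain ⟨n, hn⟩ : ∃ n, time z = n + 1 := by
    refine Nat.exists_eq_succ_of_ne_zero fun h0 => ?_
    have := htime z hz
    rw [h0] at this
    obtain ⟨τ, P, hτ, -⟩ := this
    exact List.not_mem_nil hτ
  obtain ⟨Q, hQ, hconc, hQY, hcard⟩ := exists_concentrated_of_badDeletion hδ hinp
    (hn ▸ htime z hz) (hmin z hz n (by omega))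
  -- A bad root x inside the part would be shielded up to `time z`, hence also at `time x`, when its
  -- tree has already been deleted.
  have hsub : bad.map (Function.Embedding.subtype _) ⊆ Y \ flatten Q := by
    intro y hy
    obtain ⟨x, hx, rfl⟩ := Finset.mem_map.mp hy
    refine Finset.mem_sdiff.mpr ⟨x.2, fun hxQ => ?_⟩
    obtain ⟨τ, P, hτ, hY, hb, -⟩ := htime x hx
    exact (shielded_levelRun hδ hinp hedges hQ hconc hQY hcard
      (fun h => (hρ x h).symm ▸ hxQ) (hn ▸ hmax x hx)).not_deleted τ P hτ hY hb
  have h1 := Finset.card_le_card hsub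
  rw [Finset.card_map, Finset.card_sdiff_of_subset hQY] at h1
  have h2 := Finset.card_le_card hQY
  omega

/-- The input of level `i` at all times. -/
noncomputable def levelInput (src tgt : E → V) (edges : ℕ → Finset E) (δ : ℝ)
    (R : ℕ → ℕ → ℕ → Rules V) (roots : ℕ → ℕ → ℕ → RootTable V) : ℕ → ℕ → LevelInput V
  | 0 => fun _ => ⟨singletons Finset.univ, Finset.univ⟩
  | i + 1 => fun t => ⟨(hierarchy src tgt edges δ R roots i t).trees.image GES.verts,
      (hierarchy src tgt edges δ R roots i t).sep⟩

theorem hierarchy_eq_levelRun (src tgt : E → V) (edges : ℕ → Finset E) (δ : ℝ)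
    (R : ℕ → ℕ → ℕ → Rules V) (roots : ℕ → ℕ → ℕ → RootTable V) (i : ℕ) :
    hierarchy src tgt edges δ R roots i =
      levelRun src tgt edges δ (R i) (roots i) (levelInput src tgt edges δ R roots i) := by
  cases i <;> rfl

theorem levelInput_succ (R : ℕ → ℕ → ℕ → Rules V) (roots : ℕ → ℕ → ℕ → RootTable V) (i : ℕ) :
    levelInput src tgt edges δ R roots (i + 1) =
      fun t =>
        let st := levelRun src tgt edges δ (R i) (roots i)
          (levelInput src tgt edges δ R roots i) t
        ⟨st.trees.image GES.verts, st.sep⟩ := by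
  rw [← hierarchy_eq_levelRun]
  rfl

/-- Information flows only upwards through the levels, so resampling a root on level i leaves the
input of that level unchanged at all times. -/
theorem levelInput_congr {R : ℕ → ℕ → ℕ → Rules V} {roots roots' : ℕ → ℕ → ℕ → RootTable V}
    (i : ℕ) (h : ∀ j < i, roots j = roots' j) :
    levelInput src tgt edges δ R roots i = levelInput src tgt edges δ R roots' i := by
  induction i with
  | zero => rfl
  | succ i ih =>
    rw [levelInput_succ, levelInput_succ, ih fun j hj => h j (by omega), h i (by omega)]

/-- The vertex sets of the trees on one level are the nodes of the next, so disjointness and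
refinement of trees pass upwards by induction. -/
theorem goodInput_levelInput (hδ : 32 ≤ δ) (R : ℕ → ℕ → ℕ → Rules V)
    (roots : ℕ → ℕ → ℕ → RootTable V) (i : ℕ) :
    GoodInput (levelInput src tgt edges δ R roots i) := by
  induction i with
  | zero =>
    exact ⟨fun _ => (isFinePacking_singletons (fun _ _ => True) ∅ 0 Finset.univ).disjoint,
      fun _ A hA => ⟨A, hA, subset_rfl⟩, fun _ => subset_rfl⟩
  | succ i ih =>
    rw [levelInput_succ]
    refine ⟨fun t X hX Y hY hne => ?_, fun t A hA => ?_, fun t =>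
      (stateRefines_levelRun_succ hδ ih t).2⟩
    · obtain ⟨σ, hσ, rfl⟩ := Finset.mem_image.mp hX
      obtain ⟨τ, hτ, rfl⟩ := Finset.mem_image.mp hY
      exact treesDisjoint_levelRun hδ ih t hσ hτ fun h => hne (by rw [h])
    · obtain ⟨σ, hσ, rfl⟩ := Finset.mem_image.mp hA
      obtain ⟨τ, hτ, hs⟩ := (stateRefines_levelRun_succ hδ ih t).1 σ hσ
      exact ⟨τ.verts, Finset.mem_image_of_mem _ hτ, hs⟩

end Run

/-! ### Resampling a single root -/

section Probability

/-- Resampling one coordinate: if for every point at most a third of the values of the coordinate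
lead to a bad point, then at most a third of all points are bad. -/
theorem card_filter_of_resample {Ω ρ : Type*} [Fintype ρ] [Nonempty ρ] {H : Finset Ω}
    {bad : Ω → Prop} {get : Ω → ρ} {set : Ω → ρ → Ω} (get_set : ∀ ω x, get (set ω x) = x)
    (set_set : ∀ ω x y, set (set ω x) y = set ω y) (set_get : ∀ ω, set ω (get ω) = ω)
    (hH : ∀ ω ∈ H, ∀ x, set ω x ∈ H)
    (hbad : ∀ ω ∈ H, 3 * (Finset.univ.filter fun x => bad (set ω x)).card ≤ Fintype.card ρ) :
    3 * (H.filter bad).card ≤ H.card := by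
  have h1 : ((H ×ˢ (Finset.univ : Finset ρ)).filter fun z => bad (set z.1 z.2)).card =
      ((H.filter bad) ×ˢ (Finset.univ : Finset ρ)).card := by
    -- Exchanging the stored value with the fresh one is an involution of H × ρ. It turns badness
    -- after resampling into badness of the first component.
    refine Finset.card_bij' (fun z _ => (set z.1 z.2, get z.1)) (fun z _ => (set z.1 z.2, get z.1))
      ?_ ?_ ?_ ?_
    · simp +contextual [hH]
    · simp +contextual [hH, set_set, set_get]
    · simp [set_set, set_get, get_set]
    · simp [set_set, set_get, get_set]
  have h2 : ((H ×ˢ (Finset.univ : Finset ρ)).filter fun z => bad (set z.1 z.2)).card =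
      ∑ ω ∈ H, (Finset.univ.filter fun x => bad (set ω x)).card := by
    simp only [Finset.card_filter, Finset.sum_product]
  have h3 : 3 * ∑ ω ∈ H, (Finset.univ.filter fun x => bad (set ω x)).card ≤
      H.card * Fintype.card ρ := by
    rw [Finset.mul_sum, ← smul_eq_mul]
    exact Finset.sum_le_card_nsmul _ _ _ hbad
  rw [← h2, h1, Finset.card_product, Finset.card_univ, ← mul_assoc] at h3
  exact Nat.le_of_mul_le_mul_right h3 Fintype.card_pos

open MeasureTheory in
theorem two_thirds_le_uniformOn {Ω : Type*} [MeasurableSpace Ω] [MeasurableSingletonClass Ω]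
    {H : Finset Ω} (hH : H.Nonempty) {good : Set Ω}
    (h : 3 * (H.filter fun ω => ω ∉ good).card ≤ H.card) :
    2 / 3 ≤ ProbabilityTheory.uniformOn (H : Set Ω) good := by
  have h1 : (H : Set Ω) ∩ good = (H.filter fun ω => ω ∈ good : Finset Ω) := by
    ext; simp
  have h2 : 2 * H.card ≤ 3 * (H.filter fun ω => ω ∈ good).card := by
    have := H.card_filter_add_card_filter_not (fun ω => ω ∈ good)
    omega
  have hpos : (H.card : ENNReal) ≠ 0 := by exact_mod_cast hH.card_pos.ne'
  rw [ProbabilityTheory.uniformOn, ProbabilityTheory.cond_apply H.measurableSet, h1,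
    Measure.count_apply_finset, Measure.count_apply_finset, ← ENNReal.div_eq_inv_mul,
    ENNReal.le_div_iff_mul_le (Or.inl hpos) (Or.inl (ENNReal.natCast_ne_top _)),
    ← ENNReal.mul_div_right_comm]
  refine ENNReal.div_le_of_le_mul ?_
  rw [mul_comm _ (3 : ENNReal)]
  exact_mod_cast h2

variable {V : Type*} [Fintype V] {T : ℕ}

instance : MeasurableSingletonClass (Coins V T) := ⟨fun _ => trivial⟩

noncomputable instance : Fintype (Coins V T) := by
  unfold Coins
  infer_instance

section UpdateEntry

variable {I J K L : Type*} {D : L → Type*} (f : I → J → K → ∀ y, D y) (i : I) (t : J) (c : K)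
  (y : L)

/-- The family `f` with one entry replaced. -/
noncomputable def updateEntry (x : D y) : I → J → K → ∀ y, D y :=
  Function.update f i (Function.update (f i) t (Function.update (f i t) c
    (Function.update (f i t c) y x)))

theorem updateEntry_self (x : D y) : updateEntry f i t c y x i t c y = x := by
  simp [updateEntry]

theorem updateEntry_updateEntry (x x' : D y) :
    updateEntry (updateEntry f i t c y x) i t c y x' = updateEntry f i t c y x' := by
  simp [updateEntry]

theorem updateEntry_eq_self : updateEntry f i t c y (f i t c y) = f := by
  simp [updateEntry]

theorem updateEntry_of_ne (x : D y) {i' : I} {t' : J} {c' : K}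
    (h : ¬ (i' = i ∧ t' = t ∧ c' = c)) : updateEntry f i t c y x i' t' c' = f i' t' c' := by
  unfold updateEntry
  by_cases hi : i' = i
  · subst hi
    by_cases ht : t' = t
    · subst ht
      have hc : c' ≠ c := by tauto
      simp [Function.update_of_ne hc]
    · simp [Function.update_of_ne ht]
  · simp [Function.update_of_ne hi]

end UpdateEntry

/-- The coins `ω` with the root of `Y` at one moment replaced. -/
noncomputable def Coins.setRoot (i : Fin (Nat.log 2 (Fintype.card V) + 1)) (t : Fin (T + 1))
    (c : Fin (Fintype.card V + 1)) (Y : {X : Finset V // X.Nonempty}) (ω : Coins V T)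
    (x : {v : V // v ∈ Y.1}) : Coins V T :=
  updateEntry ω i t c Y x

variable {i : Fin (Nat.log 2 (Fintype.card V) + 1)} {t : Fin (T + 1)}
  {c : Fin (Fintype.card V + 1)} {Y : {X : Finset V // X.Nonempty}}

theorem Coins.setRoot_apply_self (ω : Coins V T) (x : {v : V // v ∈ Y.1}) :
    ω.setRoot i t c Y x i t c Y = x :=
  updateEntry_self (D := fun Y : {X : Finset V // X.Nonempty} => {v : V // v ∈ Y.1})
    ω i t c Y x

theorem Coins.setRoot_setRoot (ω : Coins V T) (x y : {v : V // v ∈ Y.1}) :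
    (ω.setRoot i t c Y x).setRoot i t c Y y = ω.setRoot i t c Y y :=
  updateEntry_updateEntry (D := fun Y : {X : Finset V // X.Nonempty} => {v : V // v ∈ Y.1})
    ω i t c Y x y

theorem Coins.setRoot_self (ω : Coins V T) : ω.setRoot i t c Y (ω i t c Y) = ω :=
  updateEntry_eq_self (D := fun Y : {X : Finset V // X.Nonempty} => {v : V // v ∈ Y.1})
    ω i t c Y

theorem Coins.setRoot_apply_of_ne (ω : Coins V T) (x : {v : V // v ∈ Y.1})
    {i' : Fin (Nat.log 2 (Fintype.card V) + 1)} {t' : Fin (T + 1)} {c' : Fin (Fintype.card V + 1)}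
    (h : ¬ (i' = i ∧ t' = t ∧ c' = c)) : ω.setRoot i t c Y x i' t' c' = ω i' t' c' :=
  updateEntry_of_ne (D := fun Y : {X : Finset V // X.Nonempty} => {v : V // v ∈ Y.1})
    ω i t c Y x h

theorem Coins.roots_coe (ω : Coins V T) : ω.roots i t c = ω i t c := by
  simp [roots, Fin.ofNat_eq_cast]

theorem Coins.roots_setRoot_of_lt (ω : Coins V T) (x : {v : V // v ∈ Y.1}) {j : ℕ}
    (hj : j < i) : (ω.setRoot i t c Y x).roots j = ω.roots j := by
  funext t' c'
  refine ω.setRoot_apply_of_ne x fun h => ?_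
  have := congrArg Fin.val h.1
  rw [Fin.val_ofNat, Nat.mod_eq_of_lt (hj.trans i.2)] at this
  omega

theorem antitone_remainingEdges {E : Type*} [Fintype E] (del : List E) :
    Antitone (remainingEdges del) := fun _ _ h =>
  Finset.sdiff_subset_sdiff subset_rfl fun _ he =>
    List.mem_toFinset.mpr (List.take_subset_take_left _ h (List.mem_toFinset.mp he))

end Probability

end DecrementalSCC

open DecrementalSCC in
theorem mainTheorem7 {V E : Type*} [Fintype V] [Fintype E] (src tgt : E → V) (del : List E)
    (δ : ℝ) (hδ : 32 ≤ δ) (R : ℕ → ℕ → ℕ → DecrementalSCC.Rules V)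
    (i : Fin (Nat.log 2 (Fintype.card V) + 1)) (t : Fin (del.length + 1))
    (c : Fin (Fintype.card V + 1)) (XInit : Finset V)
    (ω₀ : DecrementalSCC.Coins V del.length) :
    2 / 3 ≤ ProbabilityTheory.uniformOn (DecrementalSCC.sameHistory ω₀ i t c)
      {ω | ∀ τ P,
        (τ, P) ∈ (DecrementalSCC.hierarchy src tgt (DecrementalSCC.remainingEdges del) δ R ω.roots
          i del.length).deleted →
        τ.initSet = XInit → τ.birth = ((t : ℕ), (c : ℕ)) →
        ∀ X' ∈ P, (X'.card : ℝ) ≤ 2 / 3 * XInit.card} := by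
  have hinp := fun ω : Coins V del.length =>
    goodInput_levelInput (src := src) (tgt := tgt) (edges := remainingEdges del) hδ R ω.roots i
  have hnot : ∀ X' : Finset V, ¬ (X'.card : ℝ) ≤ 2 / 3 * XInit.card →
      2 * XInit.card < 3 * X'.card := by
    intro X' h
    have : (2 * XInit.card : ℝ) < 3 * X'.card := by linarith
    exact_mod_cast this
  have hne : (sameHistory ω₀ i t c).toFinset.Nonempty :=
    ⟨ω₀, Set.mem_toFinset.mpr fun _ _ _ _ => rfl⟩
  simp only [hierarchy_eq_levelRun]
  rw [← Set.coe_toFinset (sameHistory ω₀ i t c)]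
  refine two_thirds_le_uniformOn hne ?_
  refine (Nat.mul_le_mul_left 3 (Finset.card_le_card (Finset.monotone_filter_right _
    (q := fun ω => BadDeletion XInit (t, c) (levelRun src tgt (remainingEdges del) δ (R i)
      (ω.roots i) (levelInput src tgt (remainingEdges del) δ R ω.roots i) del.length))
    fun ω _ hω => ?_))).trans ?_
  · simp only [Set.mem_ofPred_eq, not_forall] at hω
    obtain ⟨τ, P, hτ, hX, hb, X', hX', hcard⟩ := hω
    exact ⟨τ, P, hτ, hX, hb, X', hX', hnot X' hcard⟩
  rcases XInit.eq_empty_or_nonempty with rfl | hX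
  -- With an empty initial set there is no root to resample, but all parts are empty too, so none is
  -- large.
  · rw [Finset.filter_false_of_mem]
    · simp
    · rintro ω - ⟨τ, P, hτ, hX, -, X', hX', hcard⟩
      have := (initBounded_levelRun hδ (hinp ω) _).2 τ P hτ X' hX'
      rw [hX, Finset.subset_empty] at this
      simp [this] at hcard
  · have : Nonempty {v : V // v ∈ XInit} := hX.to_subtype
    refine card_filter_of_resample (get := fun ω => ω i t c ⟨XInit, hX⟩)
      (set := fun ω x => ω.setRoot i t c ⟨XInit, hX⟩ x)
      (fun ω x => ω.setRoot_apply_self x) (fun ω x y => ω.setRoot_setRoot x y)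
      (fun ω => ω.setRoot_self) (fun ω hω x => ?_) fun ω _ => ?_
    -- The resampled entry belongs to the moment itself, and the history fixes only strictly earlier
    -- ones.
    · rw [Set.mem_toFinset] at hω ⊢
      intro i' t' c' h
      rw [ω.setRoot_apply_of_ne x, hω i' t' c' h]
      rintro ⟨rfl, rfl, rfl⟩
      simp at h
    · have hinput : ∀ x, levelInput src tgt (remainingEdges del) δ R
          (ω.setRoot i t c ⟨XInit, hX⟩ x).roots i =
            levelInput src tgt (remainingEdges del) δ R ω.roots i := fun x =>
        levelInput_congr _ fun j hj => ω.roots_setRoot_of_lt x hj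
      simp only [hinput, Fintype.card_coe]
      refine card_bad_roots hδ (hinp ω) (antitone_remainingEdges del) t c _ XInit
        (fun x => (ω.setRoot i t c ⟨XInit, hX⟩ x).roots i) fun x h => ?_
      rw [Coins.roots_coe, Coins.setRoot_apply_self]
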